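/- Let $n\ge 0$, let $X\subset\mathbb P^n=\mathbb P^n_{\mathbb C}$ be a closed subscheme of dimension one with ideal sheaf $\mathcal I_X$, and let $\mathcal I_X^*\supseteq\mathcal I_X$ be the ideal sheaf whose sections are the functions on $\mathbb P^n$ whose image in $\mathcal O_X$ has support of dimension $<1$. Let $X_1\subset\mathbb P^n$ be the closed subscheme defined by $\mathcal I_X^*$ (that is, $X$ with its isolated and embedded point components thrown away). Assume that $X$ is a curve with point components, i.e. that $X_1$ (the curve part of $X$) is reduced and all of its irreducible components have dimension one. Then the length $\operatorname{adeg}_0X:=\ell(\mathcal I_X^*/\mathcal I_X)$ is finite, and for every integer $r$: if $X_1$ is $r$-regular, then $X$ is $(r+\operatorname{adeg}_0X)$-regular. Here a closed subscheme $Z\subset\mathbb P^n$ with ideal sheaf $\mathcal I_Z$ is called $m$-regular if $H^i(\mathbb P^n,\mathcal I_Z(m-i))=0$ for all $i>0$. -/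

import Mathlib

namespace CurveReg

open AlgebraicGeometry CategoryTheory

section Ring
variable {A : Type*} [CommRing A]

theorem supportDim_lt_one_iff (I : Ideal A) (f : A) :
    Module.supportDim A (Submodule.span A {Ideal.Quotient.mk I f}) < 1 ↔
      ∀ p : Ideal A, p.IsPrime → (∀ h, h * f ∈ I → h ∈ p) → p.IsMaximal := by
  have hsupp : ∀ p : PrimeSpectrum A,
      p ∈ Module.support A (Submodule.span A {Ideal.Quotient.mk I f}) ↔
        ∀ h, h * f ∈ I → h ∈ p.asIdeal := by
    intro p
    rw [Module.mem_support_iff_of_finite, SetLike.le_def]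
    refine forall_congr' fun h ↦ ?_
    rw [Submodule.mem_annihilator_span_singleton, Algebra.smul_def, Ideal.Quotient.algebraMap_eq,
      ← map_mul, Ideal.Quotient.eq_zero_iff_mem]
  have h01 : Module.supportDim A (Submodule.span A {Ideal.Quotient.mk I f}) < 1 ↔
      Module.supportDim A (Submodule.span A {Ideal.Quotient.mk I f}) ≤ 0 := by
    simpa using ENat.WithBot.lt_add_one_iff (m := 0)
      (n := Module.supportDim A (Submodule.span A {Ideal.Quotient.mk I f}))
  rw [h01, Module.supportDim, Order.krullDim_nonpos_iff_forall_isMax]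
  constructor
  · intro H p hp hpf
    obtain ⟨m, hm, hpm⟩ := Ideal.exists_le_maximal p hp.ne_top
    have h1 := (hsupp ⟨p, hp⟩).2 hpf
    have h2 := (hsupp ⟨m, hm.isPrime⟩).2 fun h hh ↦ hpm (hpf h hh)
    have h3 : m ≤ p := H ⟨_, h1⟩ (b := ⟨_, h2⟩) hpm
    rwa [le_antisymm hpm h3]
  · rintro H ⟨p, hp⟩ ⟨q, hq⟩ hpq
    have := H p.asIdeal p.2 ((hsupp p).1 hp)
    have e : p.asIdeal = q.asIdeal := this.eq_of_le q.2.ne_top hpq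
    exact e.ge

/-- For an ideal `I` of a ring `A`, the ideal of those `f ∈ A` whose image in `A ⧸ I` has
support of dimension `< 1`. -/
def dropPoints (I : Ideal A) : Ideal A where
  carrier := {f | Module.supportDim A (Submodule.span A {Ideal.Quotient.mk I f}) < 1}
  zero_mem' := by
    rw [Set.mem_ofPred_eq, supportDim_lt_one_iff]
    intro p hp h
    exact absurd (p.eq_top_iff_one.2 (h 1 (by simp))) hp.ne_top
  add_mem' := by
    intro a b ha hb
    rw [Set.mem_ofPred_eq, supportDim_lt_one_iff] at *
    intro p hp h
    by_cases hpa : ∀ h, h * a ∈ I → h ∈ p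
    · exact ha p hp hpa
    · by_cases hpb : ∀ h, h * b ∈ I → h ∈ p
      · exact hb p hp hpb
      · push Not at hpa hpb
        obtain ⟨s, hs, hsp⟩ := hpa
        obtain ⟨t, ht, htp⟩ := hpb
        have : s * t ∈ p := h _ (by
          have : s * t * (a + b) = t * (s * a) + s * (t * b) := by ring
          rw [this]
          exact I.add_mem (I.mul_mem_left _ hs) (I.mul_mem_left _ ht))
        exact absurd (hp.mem_or_mem this) (by tauto)
  smul_mem' := by
    intro c a ha
    rw [Set.mem_ofPred_eq, supportDim_lt_one_iff] at *
    intro p hp h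
    refine ha p hp fun s hs ↦ h s ?_
    have : s * c • a = c * (s * a) := by simp; ring
    rw [this]
    exact I.mul_mem_left _ hs

theorem mem_dropPoints {I : Ideal A} {f : A} :
    f ∈ dropPoints I ↔ ∀ p : Ideal A, p.IsPrime → (∀ h, h * f ∈ I → h ∈ p) → p.IsMaximal :=
  supportDim_lt_one_iff I f

theorem map_dropPoints [IsNoetherianRing A] [IsJacobsonRing A] {B : Type*} [CommRing B]
    [Algebra A B] (g : A) [IsLocalization.Away g B] (I : Ideal A) :
    (dropPoints I).map (algebraMap A B) = dropPoints (I.map (algebraMap A B)) := by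
  have memMap : ∀ (J : Ideal A) (x : A), algebraMap A B x ∈ J.map (algebraMap A B) ↔
      ∃ n : ℕ, g ^ n * x ∈ J := by
    intro J x
    have := IsLocalization.mk'_mem_map_algebraMap_iff (Submonoid.powers g) B J x 1
    rw [IsLocalization.mk'_one] at this
    rw [this]
    simp [Submonoid.mem_powers_iff]
  have hg : IsUnit (algebraMap A B g) := IsLocalization.Away.algebraMap_isUnit g
  have surj : ∀ b : B, ∃ (x : A) (n : ℕ), b * algebraMap A B g ^ n = algebraMap A B x :=
    fun b ↦ by
      obtain ⟨n, x, h⟩ := IsLocalization.Away.surj g b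
      exact ⟨x, n, h⟩
  apply le_antisymm
  · rw [Ideal.map_le_iff_le_comap]
    intro f hf
    rw [Ideal.mem_comap, mem_dropPoints]
    rw [mem_dropPoints] at hf
    intro p hp h
    have hp' : (p.comap (algebraMap A B)).IsMaximal := by
      refine hf _ (hp.comap _) fun s hs ↦ h _ ?_
      rw [← map_mul]
      exact Ideal.mem_map_of_mem _ hs
    exact (IsLocalization.isMaximal_iff_isMaximal_disjoint B g p).2 ⟨hp', fun hgp ↦
      hp.ne_top (Ideal.eq_top_of_isUnit_mem _ hgp hg)⟩
  · intro b hb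
    obtain ⟨f, n, hbf⟩ := surj b
    suffices algebraMap A B f ∈ (dropPoints I).map (algebraMap A B) by
      rw [← hbf] at this
      exact (Ideal.mul_unit_mem_iff_mem _ (hg.pow n)).1 this
    have hf : algebraMap A B f ∈ dropPoints (I.map (algebraMap A B)) := by
      rw [← hbf]
      exact Ideal.mul_mem_right _ _ hb
    let J : ℕ →o Ideal A :=
      ⟨fun n ↦ Submodule.comap (LinearMap.mulLeft A (g ^ n)) I, fun m n hmn x hx ↦ by
        have hx' : g ^ m * x ∈ I := hx
        change g ^ n * x ∈ I
        obtain ⟨k, rfl⟩ := Nat.exists_eq_add_of_le hmn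
        have : g ^ (m + k) * x = g ^ k * (g ^ m * x) := by ring
        rw [this]
        exact I.mul_mem_left _ hx'⟩
    obtain ⟨N, hN⟩ := monotone_stabilizes_iff_noetherian.2 (inferInstance : IsNoetherian A A) J
    have hstab : ∀ (n : ℕ) (x : A), g ^ n * (g ^ N * x) ∈ I → g ^ N * x ∈ I := by
      intro n x hx
      have : x ∈ J (N + n) := by
        change g ^ (N + n) * x ∈ I
        convert hx using 1
        ring
      rw [← hN (N + n) (by omega)] at this
      exact this
    rw [memMap]
    refine ⟨N, mem_dropPoints.2 fun p hp hpf ↦ ?_⟩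
    let K : Ideal A := Submodule.comap (LinearMap.mulRight A (g ^ N * f)) I
    have hK : ∀ h, h ∈ K ↔ h * (g ^ N * f) ∈ I := fun h ↦ Iff.rfl
    obtain ⟨q, hq, hqp⟩ := Ideal.exists_minimalPrimes_le (I := K) (J := p) fun h hh ↦ hpf h hh
    have hqprime : q.IsPrime := hq.1.1
    have hgq : g ∉ q := by
      intro hgq
      obtain ⟨y, hy, hgy⟩ := Ideal.exists_mul_mem_of_mem_minimalPrimes hq hgq
      refine hy ?_
      rw [hK] at hgy ⊢
      have := hstab 1 (y * f) (by convert hgy using 1; ring)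
      convert this using 1
      ring
    have hdisj : Disjoint (Submonoid.powers g : Set A) (q : Set A) :=
      (Ideal.disjoint_powers_iff_notMem_of_isPrime g).2 hgq
    have hqB := IsLocalization.isPrime_of_isPrime_disjoint (Submonoid.powers g) B q hqprime hdisj
    have hcomap := IsLocalization.under_map_of_isPrime_disjoint (Submonoid.powers g) B hqprime hdisj
    have hmax : (q.map (algebraMap A B)).IsMaximal := by
      refine mem_dropPoints.1 hf _ hqB fun h hh ↦ ?_
      obtain ⟨x, m, hx⟩ := surj h
      refine (Ideal.mul_unit_mem_iff_mem _ (hg.pow m)).1 ?_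
      rw [hx]
      have h2 : algebraMap A B (x * f) ∈ I.map (algebraMap A B) := by
        rw [map_mul, ← hx]
        have : h * algebraMap A B g ^ m * algebraMap A B f =
          algebraMap A B g ^ m * (h * algebraMap A B f) := by ring
        rw [this]
        exact Ideal.mul_mem_left _ _ hh
      obtain ⟨k, hk⟩ := (memMap _ _).1 h2
      refine Ideal.mem_map_of_mem _ (hq.1.2 ?_)
      rw [hK]
      have h3 := hstab k (x * f) (by
        have : g ^ k * (g ^ N * (x * f)) = g ^ N * (g ^ k * (x * f)) := by ring
        rw [this]
        exact I.mul_mem_left _ hk)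
      convert h3 using 1
      ring
    have hqmax := ((IsLocalization.isMaximal_iff_isMaximal_disjoint B g _).1 hmax).1
    rw [hcomap] at hqmax
    rwa [← hqmax.eq_of_le hp.ne_top hqp]

end Ring

section IdealSheaf

/-- For the closed subscheme `X` of `P` with ideal sheaf `I`, the ideal sheaf of the subscheme
`X₁` obtained by throwing away the dimension zero components of `X`: its sections over an affine
open `U` are the functions whose image in `𝒪_X` has support of dimension `< 1`. -/
def curvePart {P : Scheme.{0}} [IsLocallyNoetherian P] [JacobsonSpace P] (I : P.IdealSheafData) :
    P.IdealSheafData where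
  ideal U := dropPoints (I.ideal U)
  map_ideal_basicOpen U f := by
    have inst := U.2.isLocalization_basicOpen f
    have : IsNoetherianRing Γ(P, U) := IsLocallyNoetherian.component_noetherian U
    have : IsJacobsonRing Γ(P, U) := by
      rw [PrimeSpectrum.isJacobsonRing_iff_jacobsonSpace]
      have := IsAffineOpen.isOpenImmersion_fromSpec (U := U.1) U.2
      exact JacobsonSpace.of_isOpenEmbedding (IsAffineOpen.fromSpec (U := U.1) U.2).isOpenEmbedding
    rw [← I.map_ideal_basicOpen U f]
    exact map_dropPoints f (I.ideal U)

end IdealSheaf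

section ProjectiveSpace

/-- The grading of `ℂ[x₀, …, xₙ]` by degree. -/
abbrev grading (n : ℕ) : ℕ → Submodule ℂ (MvPolynomial (Fin (n + 1)) ℂ) :=
  MvPolynomial.homogeneousSubmodule (Fin (n + 1)) ℂ

noncomputable instance (n : ℕ) : GradedAlgebra (grading n) := MvPolynomial.gradedAlgebra

/-- The projective space `ℙⁿ` over `ℂ`. -/
noncomputable abbrev PSpace (n : ℕ) : Scheme.{0} := Proj (grading n)

instance (n : ℕ) : Algebra.FiniteType (grading n 0) (MvPolynomial (Fin (n + 1)) ℂ) := by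
  have : IsScalarTower ℂ (grading n 0) (MvPolynomial (Fin (n + 1)) ℂ) := ⟨fun a b c ↦ smul_mul_assoc a b.1 c⟩
  exact Algebra.FiniteType.of_restrictScalars_finiteType ℂ _ _

theorem isField_grading_zero (n : ℕ) : IsField (grading n 0) := by
  have h : Function.Surjective (algebraMap ℂ (grading n 0)) := by
    rintro ⟨x, hx⟩
    have hx' : x ∈ (1 : Submodule ℂ (MvPolynomial (Fin (n + 1)) ℂ)) := by
      rwa [← MvPolynomial.homogeneousSubmodule_zero]
    obtain ⟨c, rfl⟩ := Submodule.mem_one.1 hx'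
    exact ⟨c, rfl⟩
  have : Nontrivial (grading n 0) :=
    ⟨0, 1, fun h ↦ zero_ne_one (congrArg Subtype.val h)⟩
  let e := RingEquiv.ofBijective (algebraMap ℂ (grading n 0)) ⟨(algebraMap ℂ _).injective, h⟩
  exact e.symm.toMulEquiv.isField (Field.toIsField ℂ)

instance (n : ℕ) : IsLocallyNoetherian (PSpace n) := by
  let := (isField_grading_zero n).toField
  exact LocallyOfFiniteType.isLocallyNoetherian (Proj.toSpecZero (grading n))

instance (n : ℕ) : JacobsonSpace (PSpace n) := by
  let := (isField_grading_zero n).toField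
  exact LocallyOfFiniteType.jacobsonSpace (Proj.toSpecZero (grading n))

end ProjectiveSpace

noncomputable section Twist

variable {n : ℕ}

/-- The homogeneous prime ideal of `ℂ[x₀, …, xₙ]` that is a point of `ℙⁿ`. -/
abbrev primeOf (x : PSpace n) : Ideal (MvPolynomial (Fin (n + 1)) ℂ) :=
  (ProjectiveSpectrum.asHomogeneousIdeal (𝒜 := grading n) x).toIdeal

instance (x : PSpace n) : (primeOf x).IsPrime :=
  ProjectiveSpectrum.isPrime (𝒜 := grading n) x

/-- The localization of `ℂ[x₀, …, xₙ]` at the homogeneous prime ideal `x`. Its elements of degree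
`0` are the stalk of `𝒪` at `x`, those of degree `d` are the stalk of `𝒪(d)` at `x`. -/
abbrev LocAt (x : PSpace n) : Type := Localization.AtPrime (primeOf x)

/-- The coordinate `xᵢ` in the localization at `x`. -/
noncomputable abbrev coord (i : Fin (n + 1)) (x : PSpace n) : LocAt x :=
  algebraMap (MvPolynomial (Fin (n + 1)) ℂ) (LocAt x) (MvPolynomial.X i)

/-- The value in the localization at `x` of a regular function near `x`. -/
noncomputable def germAt {V : (PSpace n).Opens} (x : PSpace n) (hx : x ∈ V) :
    Γ(PSpace n, V) →+* LocAt x :=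
  (algebraMap (HomogeneousLocalization.AtPrime (grading n) (primeOf x)) (LocAt x)).comp
    (openToLocalization (grading n) V x hx).hom

theorem germAt_res {V W : (PSpace n).Opens} (h : W ≤ V) (x : PSpace n) (hx : x ∈ W)
    (f : Γ(PSpace n, V)) :
    germAt x hx ((PSpace n).presheaf.map (homOfLE h).op f) = germAt x (h hx) f := rfl

/-- The sections over `U` of the twist `I(d) = I ⊗ 𝒪(d)` of an ideal sheaf `I` on `ℙⁿ`, as families
of elements of the localizations at the points of `U`: on `D₊(xᵢ)`, where `𝒪(d)` is freely
generated by `xᵢ ^ d`, such a family is locally `f * xᵢ ^ d` with a section `f` of `I`. -/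
def IsTwistSection (I : (PSpace n).IdealSheafData) (d : ℤ) {U : (PSpace n).Opens}
    (s : ∀ x : U, LocAt x.1) : Prop :=
  ∀ (i : Fin (n + 1)) (x : U), MvPolynomial.X i ∉ primeOf x.1 →
    ∃ (V : (PSpace n).affineOpens) (hVU : V.1 ≤ U), x.1 ∈ V.1 ∧ ∃ f ∈ I.ideal V,
      ∀ (y : PSpace n) (hy : y ∈ V.1), MvPolynomial.X i ∉ primeOf y ∧
        s ⟨y, hVU hy⟩ * coord i y ^ (-d).toNat = germAt y hy f * coord i y ^ d.toNat

theorem exists_affine_le {U : (PSpace n).Opens} {x : PSpace n} (hx : x ∈ U) :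
    ∃ V : (PSpace n).affineOpens, x ∈ V.1 ∧ V.1 ≤ U := by
  obtain ⟨_, ⟨V, hV, rfl⟩, hxV, hVU⟩ := (PSpace n).isBasis_affineOpens.exists_subset_of_mem_open hx U.2
  exact ⟨⟨_, hV⟩, hxV, hVU⟩

variable (I : (PSpace n).IdealSheafData) (d : ℤ)

/-- The condition `IsTwistSection` is local. -/
def twistPredicate : TopCat.LocalPredicate (X := (PSpace n).toTopCat) (fun x ↦ LocAt x) where
  pred s := IsTwistSection I d s
  res {U V} j s hs i x hx := by
    obtain ⟨W, hWV, hxW, f, hf, h⟩ := hs i ⟨x.1, j.le x.2⟩ hx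
    obtain ⟨W', hxW', hW'⟩ := exists_affine_le (U := W.1 ⊓ U) ⟨hxW, x.2⟩
    exact ⟨W', hW'.trans inf_le_right, hxW', _,
      I.ideal_le_comap_ideal (hW'.trans inf_le_left) hf, fun y hy ↦ h y (hW' hy).1⟩
  locality {U} s hs i x hx := by
    obtain ⟨V, hxV, j, h⟩ := hs x
    obtain ⟨W, hWV, hxW, f, hf, h⟩ := h i ⟨x.1, hxV⟩ hx
    exact ⟨W, hWV.trans j.le, hxW, f, hf, h⟩

/-- The sections of `I(d)` over `U` form a group. -/
def twistSections (U : (PSpace n).Opens) : AddSubgroup (∀ x : U, LocAt x.1) where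
  carrier := {s | IsTwistSection I d s}
  zero_mem' i x hx := by
    let D : (PSpace n).Opens := ProjectiveSpectrum.basicOpen (grading n) (MvPolynomial.X i)
    obtain ⟨V, hxV, hV⟩ := exists_affine_le (U := U ⊓ D) (x := x.1) ⟨x.2, hx⟩
    refine ⟨V, hV.trans inf_le_left, hxV, 0, zero_mem _, fun y hy ↦ ⟨(hV hy).2, ?_⟩⟩
    simp
  add_mem' {s t} hs ht i x hx := by
    obtain ⟨V, hVU, hxV, f, hf, h⟩ := hs i x hx
    obtain ⟨W, hWU, hxW, g, hg, h'⟩ := ht i x hx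
    obtain ⟨V', hxV', hV'⟩ := exists_affine_le (U := V.1 ⊓ W.1) ⟨hxV, hxW⟩
    refine ⟨V', hV'.trans (inf_le_left.trans hVU), hxV', _, add_mem
      (I.ideal_le_comap_ideal (hV'.trans inf_le_left) hf)
      (I.ideal_le_comap_ideal (hV'.trans inf_le_right) hg), fun y hy ↦ ⟨(h y (hV' hy).1).1, ?_⟩⟩
    rw [map_add, add_mul]
    exact (add_mul _ _ _).trans (congrArg₂ _ (h y (hV' hy).1).2 (h' y (hV' hy).2).2)
  neg_mem' {s} hs i x hx := by
    obtain ⟨V, hVU, hxV, f, hf, h⟩ := hs i x hx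
    refine ⟨V, hVU, hxV, -f, neg_mem hf, fun y hy ↦ ⟨(h y hy).1, ?_⟩⟩
    rw [map_neg]
    exact (neg_mul _ _).trans ((congrArg _ (h y hy).2).trans (neg_mul _ _).symm)

/-- The presheaf of abelian groups `U ↦ I(d)(U)`. -/
def twistPresheaf : TopCat.Presheaf AddCommGrpCat.{0} (PSpace n).toTopCat where
  obj U := AddCommGrpCat.of (twistSections I d U.unop)
  map j := AddCommGrpCat.ofHom
    { toFun s := ⟨fun x ↦ s.1 ⟨x.1, j.unop.le x.2⟩, (twistPredicate I d).res j.unop s.1 s.2⟩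
      map_zero' := rfl
      map_add' _ _ := rfl }

/-- The twist `I(d)` of an ideal sheaf `I` on `ℙⁿ`, as a sheaf of abelian groups. -/
def twist : TopCat.Sheaf AddCommGrpCat.{0} (PSpace n).toTopCat :=
  ⟨twistPresheaf I d, (TopCat.Presheaf.isSheaf_iff_isSheaf_comp (forget AddCommGrpCat) _).mpr
    (TopCat.Presheaf.isSheaf_of_iso
      (NatIso.ofComponents (fun _ ↦ Iso.refl _) (by cat_disch) :
        (TopCat.subsheafToTypes (twistPredicate I d)).1 ≅ twistPresheaf I d ⋙ forget _)
      (TopCat.subsheafToTypes (twistPredicate I d)).2)⟩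

/-- The closed subscheme of `ℙⁿ` with ideal sheaf `I` is `m`-regular:
`Hⁱ(ℙⁿ, I(m - i)) = 0` for all `i > 0`. -/
def IsRegular (m : ℤ) : Prop :=
  ∀ i : ℕ, 0 < i → Subsingleton (Sheaf.H (twist I (m - i)) i)

end Twist

section Curve

variable {n : ℕ} (X : (PSpace n).IdealSheafData)

/-- The closed subscheme `X` of `ℙⁿ` (given by its ideal sheaf) is a curve with point components. -/
structure IsCurveWithPointComponents : Prop where
  dim_eq_one : topologicalKrullDim X.subscheme = 1
  isReduced_curvePart : AlgebraicGeometry.IsReduced (curvePart X).subscheme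
  equidimensional_curvePart : ∀ Z ∈ irreducibleComponents (curvePart X).subscheme,
    topologicalKrullDim Z = 1

/-- The `0`-th arithmetic degree of `X`: the length of `I* / I`, that is, the supremum of the
lengths of chains of ideal sheaves between the ideal sheaf `I` of `X` and the ideal sheaf `I*` of
its curve part (these correspond to the coherent submodules of `I* / I`). -/
noncomputable def adegZero : WithBot ℕ∞ :=
  Order.krullDim (Set.Icc X (curvePart X))

end Curve
end CurveReg

/-!
The length of `I* / I` is the length of a maximal chain `I = I₀ ⋖ I₁ ⋖ ⋯ ⋖ I_l = I*` of ideal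
sheaves, and it suffices to show that the regularity goes up by at most one at each step of the
chain, going down from `I*`.

*One step.* If `I ⋖ J`, then Nakayama's lemma (`exists_isMaximal_not_le_sup_mul`) gives a closed
point `p` whose ideal sheaf annihilates `J / I`. So `J(d) / I(d)` is a skyscraper sheaf at `p`
(`twistSequence_shortExact`). Its stalk is a complex vector space, hence a divisible and so an
injective abelian group, and the skyscraper sheaf is an injective sheaf, as stalks are exact
(`injective_skyscraper`); in particular it is acyclic. If `J` is `r`-regular, it is also
`(r + 1)`-regular, and the long exact sequence shows `Hⁱ(I(r + 1 - i)) = 0` at once for `i ≥ 2`. For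
`i = 1` one needs that global sections of `J(r)` generate its stalk at `p` modulo that of `I(r)`.

*Castelnuovo–Mumford theory.* The Koszul complex of the coordinates `x₀, …, xₙ`, with terms sums of
copies of `J(d - p)`, is exact, as one of the coordinates is invertible at each point. Dimension
shifting along it shows that an `r`-regular `J` is `(r + 1)`-regular (`IsRegular.succ`), and that
the global sections of `J(r + 1)` are sums of products of coordinates with global sections of `J(r)`
(`IsRegular.exists_sum`). Now a section of `J` near `p`, multiplied by a function that is invertible
at `p`, extends to a global section of a high twist `J(r + q)`. By the Nullstellensatz each
coordinate acts on the fibre at `p` as a complex multiple of a coordinate `xᵢ` that does not vanish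
at `p`. Hence this global section is, at `p` and modulo `I`, the product of `xᵢ ^ q` with a global
section of `J(r)` (`stalkTwist_le_globalTwist_sup`).

*Finiteness.* On an affine open set, the module `I* / I` is noetherian, and its support consists of
closed points, so that it has finite length (`isArtinian_dropPoints`). An ideal sheaf is determined
by its ideals on the `n + 1` standard open sets, so chains between `I` and `I*` have bounded length
(`adegZero_ne_top`).
-/

namespace CurveReg

open CategoryTheory Limits Abelian TopologicalSpace Opposite AlgebraicGeometry

/-! ### Vanishing of `Ext` in exact sequences -/

section Homological

universe w v u

variable {A : Type u} [Category.{v} A] [Abelian A]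

/-- An exact sequence breaks up into short exact sequences between kernels. -/
theorem shortExact_kernel {S : ShortComplex A} (hS : S.Exact) :
    (ShortComplex.mk (kernel.ι S.f) (kernel.lift S.g S.f S.zero) (by
      rw [← cancel_mono (kernel.ι S.g)]; simp)).ShortExact := by
  have : Epi (kernel.lift S.g S.f S.zero) := S.exact_iff_epi_kernel_lift.1 hS
  refine .mk' ?_ inferInstance inferInstance
  refine ShortComplex.exact_of_f_is_kernel _ (KernelFork.IsLimit.ofι' _ _ fun k hk ↦ ?_)
  have hk' : k ≫ S.f = 0 := by
    have := congrArg (· ≫ kernel.ι S.g) hk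
    simpa using this
  exact ⟨kernel.lift S.f k hk', kernel.lift_ι S.f k hk'⟩

variable [HasExt.{w} A] (Z : A)

theorem subsingleton_ext_of_isZero {M : A} (hM : IsZero M) (k : ℕ) : Subsingleton (Ext Z M k) := by
  refine subsingleton_of_forall_eq 0 fun x ↦ ?_
  rw [← Ext.comp_mk₀_id x, hM.eq_of_src (𝟙 M) 0, Ext.mk₀_zero, Ext.comp_zero]

/-- In the long exact sequence, the term of `S.X₁` in degree `k + 1` vanishes if that of `S.X₂` does
and the preceding map is surjective. -/
theorem subsingleton_ext_X₁ {S : ShortComplex A} (hS : S.ShortExact) {k : ℕ}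
    (h₂ : Subsingleton (Ext Z S.X₂ (k + 1)))
    (h₃ : ∀ y : Ext Z S.X₃ k, ∃ x : Ext Z S.X₂ k, x.comp (Ext.mk₀ S.g) (add_zero k) = y) :
    Subsingleton (Ext Z S.X₁ (k + 1)) := by
  refine subsingleton_of_forall_eq 0 fun x ↦ ?_
  obtain ⟨y, rfl⟩ := Ext.covariant_sequence_exact₁ Z hS x (Subsingleton.elim _ _) rfl
  obtain ⟨z, rfl⟩ := h₃ y
  rw [Ext.comp_assoc_of_second_deg_zero]
  simp

theorem subsingleton_ext_X₃ {S : ShortComplex A} (hS : S.ShortExact) {k : ℕ}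
    (h₂ : Subsingleton (Ext Z S.X₂ k)) (h₁ : Subsingleton (Ext Z S.X₁ (k + 1))) :
    Subsingleton (Ext Z S.X₃ k) := by
  refine subsingleton_of_forall_eq 0 fun x ↦ ?_
  obtain ⟨y, rfl⟩ := Ext.covariant_sequence_exact₃ Z hS x rfl (Subsingleton.elim _ _)
  rw [Subsingleton.elim y 0, Ext.zero_comp]

theorem exists_comp_mk₀_of_subsingleton {S : ShortComplex A} (hS : S.ShortExact) {k : ℕ}
    (h₁ : Subsingleton (Ext Z S.X₁ (k + 1))) (y : Ext Z S.X₃ k) :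
    ∃ x : Ext Z S.X₂ k, x.comp (Ext.mk₀ S.g) (add_zero k) = y :=
  Ext.covariant_sequence_exact₃ Z hS y rfl (Subsingleton.elim _ _)

theorem subsingleton_ext_biproduct [HasFiniteBiproducts A] {J : Type} [Finite J] (M : J → A) (k : ℕ)
    (h : ∀ j, Subsingleton (Ext Z (M j) k)) : Subsingleton (Ext Z (⨁ M) k) := by
  have := Fintype.ofFinite J
  refine subsingleton_of_forall_eq 0 fun x ↦ ?_
  have e : (𝟙 (⨁ M)) = ∑ j, biproduct.π M j ≫ biproduct.ι M j := (biproduct.total (f := M)).symm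
  rw [← Ext.comp_mk₀_id x, e]
  have : Ext.mk₀ (∑ j, biproduct.π M j ≫ biproduct.ι M j) =
      ∑ j, (Ext.mk₀ (biproduct.π M j)).comp (Ext.mk₀ (biproduct.ι M j)) (add_zero 0) := by
    simp only [Ext.mk₀_comp_mk₀]
    exact map_sum (Ext.addEquiv₀ (X := ⨁ M) (Y := ⨁ M)).symm _ _
  rw [this, Ext.comp_sum]
  refine Finset.sum_eq_zero fun j _ ↦ ?_
  rw [← Ext.comp_assoc_of_second_deg_zero, Subsingleton.elim (x.comp (Ext.mk₀ (biproduct.π M j)) _)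
      0,
    Ext.zero_comp]

theorem subsingleton_ext_of_retract {M N : A} (i : M ⟶ N) (r : N ⟶ M) (h : i ≫ r = 𝟙 M) (k : ℕ)
    (hN : Subsingleton (Ext Z N k)) : Subsingleton (Ext Z M k) := by
  refine subsingleton_of_forall_eq 0 fun x ↦ ?_
  rw [← Ext.comp_mk₀_id x, ← h, ← Ext.mk₀_comp_mk₀, ← Ext.comp_assoc_of_second_deg_zero,
    Subsingleton.elim (x.comp (Ext.mk₀ i) _) 0, Ext.zero_comp]

variable {C : ℕ → A} (d : ∀ p, C (p + 1) ⟶ C p) (hd : ∀ p, d (p + 1) ≫ d p = 0)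

include hd in
/-- Dimension shifting along a finite exact sequence `⋯ → C₂ → C₁ → C₀`: the kernel of `C₁ → C₀` has
no `Ext` in degree `k` if `C₂`, `C₃`, … have none in the degrees `k`, `k + 1`, …; the same holds
from `C_p` on. -/
theorem subsingleton_ext_kernel (hex : ∀ p, (ShortComplex.mk _ _ (hd p)).Exact)
    {N : ℕ} (hN : ∀ p, N < p → IsZero (C p)) (p k : ℕ)
    (h : ∀ q, Subsingleton (Ext Z (C (p + 2 + q)) (k + q))) :
    Subsingleton (Ext Z (kernel (d p)) k) := by
  -- Descending induction on `p`, starting where the sequence has become zero.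
  suffices ∀ m p k, N < p + 1 + m → (∀ q, Subsingleton (Ext Z (C (p + 2 + q)) (k + q))) →
      Subsingleton (Ext Z (kernel (d p)) k) from this N p k (by omega) h
  intro m
  induction m with
  | zero =>
    intro p k hp _
    refine subsingleton_ext_of_isZero Z ?_ k
    exact IsZero.of_mono (kernel.ι (d p)) (hN _ hp)
  | succ m ih =>
    intro p k hp h
    refine subsingleton_ext_X₃ Z (shortExact_kernel (hex p)) (h 0)
        (ih (p + 1) (k + 1) (by omega) fun q ↦ ?_)
    have := h (q + 1)
    rwa [show p + 2 + (q + 1) = p + 1 + 2 + q by ring, show k + (q + 1) = k + 1 + q by ring] at this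

end Homological

/-! ### The Koszul complex in a preadditive category -/

section KoszulSign

variable {ι : Type} [LinearOrder ι]

/-- The sign of moving `j` to its place in the ordered set `insert j S`. -/
def koszulSign (j : ι) (S : Finset ι) : ℤ := (-1) ^ (S.filter (· < j)).card

theorem koszulSign_mul_self (j : ι) (S : Finset ι) : koszulSign j S * koszulSign j S = 1 := by
  rw [koszulSign, ← mul_pow]
  simp

theorem koszulSign_insert_of_lt {j k : ι} (h : j < k) {S : Finset ι} (hj : j ∉ S) :
    koszulSign k (insert j S) = -koszulSign k S := by
  rw [koszulSign, koszulSign, Finset.filter_insert, if_pos h,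
    Finset.card_insert_of_notMem (by simp [hj]), pow_succ]
  ring

theorem koszulSign_insert_of_gt {j k : ι} (h : k < j) (S : Finset ι) :
    koszulSign k (insert j S) = koszulSign k S := by
  rw [koszulSign, koszulSign, Finset.filter_insert, if_neg h.not_gt]

theorem koszulSign_anticomm {j k : ι} (h : j ≠ k) {S : Finset ι} (hj : j ∉ S) (hk : k ∉ S) :
    koszulSign j S * koszulSign k (insert j S) = -(koszulSign k S * koszulSign j (insert k S)) := by
  rcases lt_or_gt_of_ne h with h | h
  · rw [koszulSign_insert_of_lt h hj, koszulSign_insert_of_gt h]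
    ring
  · rw [koszulSign_insert_of_gt h, koszulSign_insert_of_lt h hk]
    ring

theorem koszulSign_insert_mul {j k : ι} (h : j ≠ k) {S : Finset ι} (hj : j ∉ S) (hk : k ∉ S) :
    koszulSign j (insert k S) * koszulSign k (insert j S) = -(koszulSign k S * koszulSign j S) := by
  rcases lt_or_gt_of_ne h with h | h
  · rw [koszulSign_insert_of_lt h hj, koszulSign_insert_of_gt h]
    ring
  · rw [koszulSign_insert_of_gt h, koszulSign_insert_of_lt h hk]
    ring

end KoszulSign

noncomputable section Koszul

universe v u

variable {A : Type u} [Category.{v} A]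

theorem map_comp_hom_apply (Φ : A ⥤ AddCommGrpCat.{0}) {L M N : A} (f : L ⟶ M) (g : M ⟶ N)
    (y : Φ.obj L) :
    (Φ.map (f ≫ g)).hom y = (Φ.map g).hom ((Φ.map f).hom y) := by
  rw [Φ.map_comp]; rfl

variable [Preadditive A]

theorem map_sum_hom_apply (Φ : A ⥤ AddCommGrpCat.{0}) [Φ.Additive] {κ : Type} (s : Finset κ)
    {M N : A} (f : κ → (M ⟶ N)) (y : Φ.obj M) :
    (Φ.map (∑ k ∈ s, f k)).hom y = ∑ k ∈ s, (Φ.map (f k)).hom y :=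
  map_sum (AddMonoidHom.mk' (fun f : M ⟶ N ↦ (Φ.map f).hom y) fun f g ↦ by
    rw [Φ.map_add]; rfl) f s

variable [HasFiniteBiproducts A] (ι : Type) [Fintype ι] (G : ℕ → A)

/-- The `p`-th term `⋀ᵖ(ℤ^ι) ⊗ G p` of the Koszul complex: a sum of copies of `G p` indexed by the
subsets of `ι` with `p` elements. -/
abbrev koszulObj (p : ℕ) : A := ⨁ fun _ : {S : Finset ι // S.card = p} ↦ G p

/-- The component of the `p`-th term of the Koszul complex that belongs to a subset `S` of `ι`,
understood to be zero if `S` does not have `p` elements. -/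
def koszulπ (p : ℕ) (S : Finset ι) : koszulObj ι G p ⟶ G p :=
  if h : S.card = p then biproduct.π (fun _ : {S : Finset ι // S.card = p} ↦ G p) ⟨S, h⟩ else 0

/-- The inclusion of the summand that belongs to a subset `S` of `ι` into the `p`-th term of the
Koszul complex, understood to be zero if `S` does not have `p` elements. -/
def koszulι (p : ℕ) (S : Finset ι) : G p ⟶ koszulObj ι G p :=
  if h : S.card = p then biproduct.ι (fun _ : {S : Finset ι // S.card = p} ↦ G p) ⟨S, h⟩ else 0

variable {ι G}

theorem koszulπ_of_ne {p : ℕ} {S : Finset ι} (h : S.card ≠ p) : koszulπ ι G p S = 0 := dif_neg h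

theorem koszulι_π_self {p : ℕ} {S : Finset ι} (h : S.card = p) :
    koszulι ι G p S ≫ koszulπ ι G p S = 𝟙 _ := by
  rw [koszulι, koszulπ, dif_pos h, dif_pos h]
  exact biproduct.ι_π_self (fun _ : {S : Finset ι // S.card = p} ↦ G p) ⟨S, h⟩

theorem koszulι_π_ne {p : ℕ} {S T : Finset ι} (h : S ≠ T) :
    koszulι ι G p S ≫ koszulπ ι G p T = 0 := by
  by_cases hS : S.card = p
  · by_cases hT : T.card = p
    · rw [koszulι, koszulπ, dif_pos hS, dif_pos hT]
      exact biproduct.ι_π_ne _ (by simpa using h)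
    · rw [koszulπ_of_ne hT, comp_zero]
  · rw [koszulι, dif_neg hS, zero_comp]

theorem koszul_total (p : ℕ) : ∑ S, koszulπ ι G p S ≫ koszulι ι G p S = 𝟙 (koszulObj ι G p) := by
  rw [← biproduct.total, ← Finset.sum_subset (Finset.subset_univ
    (Finset.univ.filter fun S : Finset ι ↦ S.card = p)), ← Finset.sum_subtype_eq_sum_filter]
  · simp only [Finset.subtype_univ]
    refine Finset.sum_congr rfl fun S _ ↦ ?_
    rw [koszulπ, koszulι, dif_pos S.2, dif_pos S.2]
  · intro S _ hS
    rw [koszulπ_of_ne (by simpa using hS), zero_comp]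

theorem koszul_hom_ext {p : ℕ} {M : A} {f g : M ⟶ koszulObj ι G p}
    (h : ∀ S, f ≫ koszulπ ι G p S = g ≫ koszulπ ι G p S) : f = g := by
  rw [← Category.comp_id f, ← Category.comp_id g, ← koszul_total]
  simp only [Preadditive.comp_sum, ← Category.assoc, h]

theorem isZero_koszulObj {p : ℕ} (hp : Fintype.card ι < p) : IsZero (koszulObj ι G p) := by
  rw [IsZero.iff_id_eq_zero]
  refine koszul_hom_ext fun S ↦ ?_
  rw [koszulπ_of_ne (by have := S.card_le_univ; omega), comp_zero, comp_zero]

theorem map_koszulπ_of_ne (Φ : A ⥤ AddCommGrpCat.{0}) [Φ.Additive] {p : ℕ} {S : Finset ι}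
    (h : S.card ≠ p)
    (b : Φ.obj (koszulObj ι G p)) :
    (Φ.map (koszulπ ι G p S)).hom b = 0 := by
  rw [koszulπ_of_ne h, Φ.map_zero]; rfl

theorem koszul_sections_ext (Φ : A ⥤ AddCommGrpCat.{0}) [Φ.Additive] {p : ℕ}
    {a b : Φ.obj (koszulObj ι G p)}
    (h : ∀ S, (Φ.map (koszulπ ι G p S)).hom a = (Φ.map (koszulπ ι G p S)).hom b) : a = b := by
  have : ∀ c : Φ.obj (koszulObj ι G p), c = ∑ S, (Φ.map (koszulι ι G p S)).hom
      ((Φ.map (koszulπ ι G p S)).hom c) := by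
    intro c
    have := congrArg (fun f ↦ (Φ.map f).hom c) (koszul_total (ι := ι) (G := G) p)
    simp only [map_sum_hom_apply, Φ.map_id] at this
    simp only [← map_comp_hom_apply]
    exact this.symm
  rw [this a, this b]
  exact Finset.sum_congr rfl fun S _ ↦ by rw [h]

variable [LinearOrder ι] (x : ι → ∀ p, G (p + 1) ⟶ G p)

/-- The Koszul differential
`(∂ a)_S = ∑ j ∉ S, ± xⱼ a_(S ∪ {j})`. -/
def koszulD (p : ℕ) : koszulObj ι G (p + 1) ⟶ koszulObj ι G p :=
  ∑ S : Finset ι, ∑ j ∈ Sᶜ, koszulSign j S •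
    koszulπ ι G (p + 1) (insert j S) ≫ x j p ≫ koszulι ι G p S

theorem koszulD_π (p : ℕ) (S : Finset ι) : koszulD x p ≫ koszulπ ι G p S =
    ∑ j ∈ Sᶜ, koszulSign j S • koszulπ ι G (p + 1) (insert j S) ≫ x j p := by
  rw [koszulD, Preadditive.sum_comp, Finset.sum_eq_single S]
  · rw [Preadditive.sum_comp]
    refine Finset.sum_congr rfl fun j hj ↦ ?_
    by_cases h : S.card = p
    · simp [koszulι_π_self h]
    · rw [koszulπ_of_ne h, koszulπ_of_ne]
      · simp
      · rw [Finset.card_insert_of_notMem (by simpa using hj)]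
        omega
  · intro T _ hT
    simp [Preadditive.sum_comp, koszulι_π_ne hT]
  · simp

theorem koszulD_comp_koszulD (hx : ∀ i j p, x i (p + 1) ≫ x j p = x j (p + 1) ≫ x i p) (p : ℕ) :
    koszulD x (p + 1) ≫ koszulD x p = 0 := by
  refine koszul_hom_ext fun S ↦ ?_
  rw [Category.assoc, koszulD_π, Preadditive.comp_sum, zero_comp]
  have : ∀ j ∈ Sᶜ, koszulD x (p + 1) ≫ (koszulSign j S • koszulπ ι G (p + 1) (insert j S) ≫ x j p) =
      ∑ k ∈ Sᶜ.erase j, (koszulSign j S * koszulSign k (insert j S)) •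
        koszulπ ι G (p + 1 + 1) (insert k (insert j S)) ≫ x k (p + 1) ≫ x j p := by
    intro j hj
    rw [Preadditive.comp_zsmul, ← Category.assoc, koszulD_π, Preadditive.sum_comp, Finset.smul_sum,
      Finset.compl_insert]
    refine Finset.sum_congr rfl fun k _ ↦ ?_
    rw [Preadditive.zsmul_comp, smul_smul, Category.assoc]
  rw [Finset.sum_congr rfl this, Finset.sum_sigma']
  -- The terms for `(j, k)` and `(k, j)` cancel.
  refine Finset.sum_involution (fun a _ ↦ ⟨a.2, a.1⟩) ?_ ?_ ?_ ?_
  · rintro ⟨j, k⟩ h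
    simp only [Finset.mem_sigma, Finset.mem_erase, Finset.mem_compl] at h
    rw [koszulSign_anticomm (Ne.symm h.2.1) h.1 h.2.2, Finset.insert_comm j k, hx j k, neg_smul,
      neg_add_cancel]
  · rintro ⟨j, k⟩ h _ h'
    simp only [Finset.mem_sigma, Finset.mem_erase, Finset.mem_compl] at h
    exact h.2.1 (congrArg Sigma.fst h')
  · rintro ⟨j, k⟩ h
    simp only [Finset.mem_sigma, Finset.mem_erase, Finset.mem_compl] at h ⊢
    exact ⟨h.2.2, Ne.symm h.2.1, h.1⟩
  · rintro ⟨j, k⟩ h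
    rfl

section Homotopy

variable (Φ : A ⥤ AddCommGrpCat.{0}) [Φ.Additive]

theorem map_koszulD_π (p : ℕ) (S : Finset ι) (b : Φ.obj (koszulObj ι G (p + 1))) :
    (Φ.map (koszulπ ι G p S)).hom ((Φ.map (koszulD x p)).hom b) =
      ∑ j ∈ Sᶜ, koszulSign j S •
        (Φ.map (x j p)).hom ((Φ.map (koszulπ ι G (p + 1) (insert j S))).hom b) := by
  rw [← map_comp_hom_apply, koszulD_π, map_sum_hom_apply]
  refine Finset.sum_congr rfl fun j _ ↦ ?_
  rw [Φ.map_zsmul, ← map_comp_hom_apply]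
  rfl

variable {x Φ} {i : ι}

/-- The contracting homotopy, applied to `b`: wedging with `i` and dividing by `xᵢ`. Only the
components at subsets that contain `i` are nonzero. -/
theorem exists_koszul_contraction (hi : ∀ p, Function.Surjective (Φ.map (x i p)).hom) (p : ℕ)
    (b : Φ.obj (koszulObj ι G p)) :
    ∃ a : Φ.obj (koszulObj ι G (p + 1)),
      (∀ T, i ∉ T → (Φ.map (koszulπ ι G (p + 1) T)).hom a = 0) ∧
      ∀ R, i ∉ R → (Φ.map (x i p)).hom ((Φ.map (koszulπ ι G (p + 1) (insert i R))).hom a) =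
        koszulSign i R • (Φ.map (koszulπ ι G p R)).hom b := by
  choose e he using hi p
  let a := ∑ R ∈ Finset.univ.filter (fun R : Finset ι ↦ i ∉ R), koszulSign i R •
    (Φ.map (koszulι ι G (p + 1) (insert i R))).hom (e ((Φ.map (koszulπ ι G p R)).hom b))
  have ha : ∀ T, (Φ.map (koszulπ ι G (p + 1) T)).hom a =
      ∑ R ∈ Finset.univ.filter (fun R : Finset ι ↦ i ∉ R), koszulSign i R •
        (Φ.map (koszulι ι G (p + 1) (insert i R) ≫ koszulπ ι G (p + 1) T)).hom
          (e ((Φ.map (koszulπ ι G p R)).hom b)) := by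
    intro T
    simp only [a, map_sum, map_zsmul, map_comp_hom_apply]
  refine ⟨a, fun T hT ↦ ?_, fun R hR ↦ ?_⟩
  · rw [ha]
    refine Finset.sum_eq_zero fun R _ ↦ ?_
    rw [koszulι_π_ne (by rintro rfl; exact hT (Finset.mem_insert_self i R)), Φ.map_zero]
    simp
  · by_cases h : R.card = p
    · rw [ha, Finset.sum_eq_single R, koszulι_π_self (by rw [Finset.card_insert_of_notMem hR, h]),
        Φ.map_id]
      · rw [map_zsmul]
        exact congrArg _ (he _)
      · intro R' hR' h'
        rw [koszulι_π_ne, Φ.map_zero]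
        · simp
        · intro h''
          refine h' ?_
          rw [← Finset.erase_insert hR, ← h'', Finset.erase_insert (by simpa using hR')]
      · simp [hR]
    · rw [map_koszulπ_of_ne Φ h,
        map_koszulπ_of_ne Φ (by rw [Finset.card_insert_of_notMem hR]; omega)]
      simp

/-- The Koszul complex is exact on sections (given by the functor `Φ`) on which one of the variables
`xᵢ` acts bijectively. -/
theorem exists_koszulD_eq (hx : ∀ i j p, x i (p + 1) ≫ x j p = x j (p + 1) ≫ x i p)
    (hi : ∀ p, Function.Bijective (Φ.map (x i p)).hom) (p : ℕ) (b : Φ.obj (koszulObj ι G (p + 1)))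
    (hb : (Φ.map (koszulD x p)).hom b = 0) :
    ∃ a, (Φ.map (koszulD x (p + 1))).hom a = b := by
  obtain ⟨a, ha, ha'⟩ := exists_koszul_contraction (fun p ↦ (hi p).2) (p + 1) b
  refine ⟨a, koszul_sections_ext Φ fun S ↦ (hi p).1 ?_⟩
  rw [map_koszulD_π]
  by_cases hiS : i ∈ S
  · obtain ⟨R, hR, rfl⟩ : ∃ R, i ∉ R ∧ S = insert i R :=
      ⟨S.erase i, Finset.notMem_erase i S, (Finset.insert_erase hiS).symm⟩
    -- The component of `∂ b = 0` at `R` expresses `xᵢ b_(R ∪ {i})` by the other `xⱼ b_(R ∪ {j})`.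
    have h0 := map_koszulD_π x Φ p R b
    rw [hb, map_zero, ← Finset.insert_erase (Finset.mem_compl.2 hR), ← Finset.compl_insert,
      Finset.sum_insert (by simp)] at h0
    have h1 : ∀ j ∈ (insert i R)ᶜ, (Φ.map (x i p)).hom (koszulSign j (insert i R) •
        (Φ.map (x j (p + 1))).hom
          ((Φ.map (koszulπ ι G (p + 1 + 1) (insert j (insert i R)))).hom a)) =
        -koszulSign i R • koszulSign j R • (Φ.map (x j p)).hom
          ((Φ.map (koszulπ ι G (p + 1) (insert j R))).hom b) := by
      intro j hj
      simp only [Finset.mem_compl, Finset.mem_insert, not_or] at hj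
      rw [map_zsmul, ← map_comp_hom_apply, hx j i, map_comp_hom_apply, Finset.insert_comm,
        ha' _ (by simp [hR, Ne.symm hj.1]),
        map_zsmul, smul_smul, smul_smul, neg_mul, ← koszulSign_insert_mul hj.1 hj.2 hR]
    rw [map_sum, Finset.sum_congr rfl h1, ← Finset.smul_sum, neg_smul, ← smul_neg,
      neg_eq_of_add_eq_zero_left h0.symm, smul_smul, koszulSign_mul_self, one_smul]
  · rw [Finset.sum_eq_single i, ha' _ hiS, smul_smul, koszulSign_mul_self, one_smul]
    · intro j _ hj
      rw [ha _ (by simp [hiS, Ne.symm hj]), map_zero, smul_zero]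
    · simp [hiS]

theorem exists_koszulD_zero_eq (hi : ∀ p, Function.Surjective (Φ.map (x i p)).hom)
    (b : Φ.obj (koszulObj ι G 0)) : ∃ a, (Φ.map (koszulD x 0)).hom a = b := by
  obtain ⟨a, ha, ha'⟩ := exists_koszul_contraction hi 0 b
  refine ⟨a, koszul_sections_ext Φ fun S ↦ ?_⟩
  by_cases hS : S.card = 0
  · rw [Finset.card_eq_zero] at hS
    subst hS
    rw [map_koszulD_π, Finset.sum_eq_single i, ha' _ (by simp), smul_smul, koszulSign_mul_self,
      one_smul]
    · intro j _ hj
      rw [ha _ (by simp [Ne.symm hj]), map_zero, smul_zero]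
    · simp
  · rw [map_koszulπ_of_ne Φ hS, map_koszulπ_of_ne Φ hS]

end Homotopy

end Koszul

/-! ### Sheaves of abelian groups on a topological space -/

noncomputable section Sheaves

variable {T : TopCat.{0}}

/-- The category of sheaves of abelian groups on a topological space. -/
abbrev AbSheaf (T : TopCat.{0}) := Sheaf (Opens.grothendieckTopology T) AddCommGrpCat.{0}

instance : HasFiniteBiproducts (AbSheaf T) := Abelian.hasFiniteBiproducts

/-- The functor of sections over an open set. -/
abbrev sectionsFunctor (V : Opens T) : AbSheaf T ⥤ AddCommGrpCat.{0} :=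
  sheafToPresheaf (Opens.grothendieckTopology T) AddCommGrpCat.{0} ⋙
      (evaluation (Opens T)ᵒᵖ AddCommGrpCat.{0}).obj (op V)

theorem injective_app_of_mono {F G : AbSheaf T} (f : F ⟶ G) [Mono f]
    (V : Opens T) : Function.Injective (f.hom.app (op V)).hom := by
  have : Mono ((sectionsFunctor V).map f) := inferInstance
  exact (AddCommGrpCat.mono_iff_injective _).1 this

theorem mono_of_injective_app {F G : AbSheaf T} (f : F ⟶ G)
    (h : ∀ V, Function.Injective (f.hom.app (op V)).hom) : Mono f := by
  have : ∀ V, Mono (f.hom.app V) := fun V ↦ (AddCommGrpCat.mono_iff_injective _).2 (h V.unop)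
  have : Mono ((sheafToPresheaf (Opens.grothendieckTopology T) AddCommGrpCat.{0}).map f) :=
      NatTrans.mono_of_mono_app f.hom
  exact (sheafToPresheaf (Opens.grothendieckTopology T) AddCommGrpCat.{0}).mono_of_mono_map this

theorem epi_of_locally {F G : AbSheaf T} (f : F ⟶ G)
    (h : ∀ (U : Opens T) (b : G.obj.obj (op U)), ∀ x ∈ U, ∃ (V : Opens T) (hV : V ≤ U), x ∈ V ∧
      ∃ a, (f.hom.app (op V)).hom a = (G.obj.map (homOfLE hV).op).hom b) : Epi f := by
  refine (TopCat.Sheaf.isLocallySurjective_iff_epi (X := T) (F := F) (G := G) f).1 ?_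
  rw [TopCat.Presheaf.isLocallySurjective_iff]
  intro U b x hx
  obtain ⟨V, hV, hxV, a, ha⟩ := h U b x hx
  exact ⟨V, hV, ⟨a, ha⟩, hxV⟩

theorem exact_of_locally (S : ShortComplex (AbSheaf T))
    (h : ∀ (U : Opens T) (b : S.X₂.obj.obj (op U)), (S.g.hom.app (op U)).hom b = 0 →
      ∀ x ∈ U, ∃ (V : Opens T) (hV : V ≤ U), x ∈ V ∧
      ∃ a, (S.f.hom.app (op V)).hom a = (S.X₂.obj.map (homOfLE hV).op).hom b) : S.Exact := by
  rw [S.exact_iff_epi_kernel_lift]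
  refine epi_of_locally _ fun U b x hx ↦ ?_
  obtain ⟨V, hV, hxV, a, ha⟩ := h U (((kernel.ι S.g).hom.app (op U)).hom b) (by
    have := map_comp_hom_apply (sectionsFunctor U) (kernel.ι S.g) S.g b
    rw [kernel.condition] at this
    rw [Functor.map_zero] at this
    exact this.symm) x hx
  refine ⟨V, hV, hxV, a, injective_app_of_mono (kernel.ι S.g) V ?_⟩
  have h1 := map_comp_hom_apply (sectionsFunctor V) (kernel.lift S.g S.f S.zero) (kernel.ι S.g) a
  rw [kernel.lift_ι] at h1
  have h2 := ConcreteCategory.congr_hom ((kernel.ι S.g).hom.naturality (homOfLE hV).op) b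
  exact h1.symm.trans (ha.trans h2.symm)

theorem exists_section_of_subsingleton_H {S : ShortComplex (AbSheaf T)}
    (hS : S.ShortExact) (h : Subsingleton (Sheaf.H S.X₁ 1)) (b : S.X₃.obj.obj (op ⊤)) :
    ∃ a, (S.g.hom.app (op ⊤)).hom a = b := by
  obtain ⟨y, hy⟩ := exists_comp_mk₀_of_subsingleton _ hS h ((Sheaf.H.equiv₀ S.X₃
      isTerminalTop).symm b)
  refine ⟨Sheaf.H.equiv₀ S.X₂ isTerminalTop y, ?_⟩
  refine (Sheaf.H.equiv₀_naturality isTerminalTop S.g y).trans ?_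
  rw [Sheaf.H.map_apply, hy]
  simp

theorem subsingleton_H_one_of_surjective {T : TopCat.{0}} {S : ShortComplex (AbSheaf T)}
    (hS : S.ShortExact) (h₂ : Subsingleton (Sheaf.H S.X₂ 1))
    (h : Function.Surjective (S.g.hom.app (op ⊤)).hom) : Subsingleton (Sheaf.H S.X₁ 1) := by
  refine subsingleton_ext_X₁ _ hS (k := 0) h₂ fun y ↦ ?_
  obtain ⟨a, ha⟩ := h (Sheaf.H.equiv₀ S.X₃ isTerminalTop y)
  refine ⟨(Sheaf.H.equiv₀ S.X₂ isTerminalTop).symm a, (Sheaf.H.equiv₀ S.X₃ isTerminalTop).injective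
      ?_⟩
  refine Eq.trans ?_ ha
  have := Sheaf.H.equiv₀_naturality isTerminalTop S.g ((Sheaf.H.equiv₀ S.X₂ isTerminalTop).symm a)
  rw [AddEquiv.apply_symm_apply] at this
  rw [this, Sheaf.H.map_apply]

section Koszul

/-! ### The Koszul complex of sheaves -/

variable {ι : Type} [Fintype ι] [LinearOrder ι] {G : ℕ → AbSheaf T}
  (x : ι → ∀ p, G (p + 1) ⟶ G p) (hx : ∀ i j p, x i (p + 1) ≫ x j p = x j (p + 1) ≫ x i p)
  (hloc : ∀ (U : Opens T), ∀ t ∈ U, ∃ V ≤ U, t ∈ V ∧ ∃ i, ∀ p,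
    Function.Bijective ((x i p).hom.app (op V)).hom)

include hloc

/-- Exactness is local, and one of the variables is locally invertible. -/
theorem exact_koszulD (p : ℕ) :
    (ShortComplex.mk _ _ (koszulD_comp_koszulD x hx p)).Exact := by
  refine exact_of_locally _ fun U b hb t ht ↦ ?_
  obtain ⟨V, hV, htV, i, hi⟩ := hloc U t ht
  refine ⟨V, hV, htV, exists_koszulD_eq (Φ := sectionsFunctor V) (i := i) hx hi p _ ?_⟩
  have h2 := ConcreteCategory.congr_hom ((koszulD x p).hom.naturality (homOfLE hV).op) b
  refine h2.trans ?_
  refine (congrArg ((koszulObj ι G p).obj.map (homOfLE hV).op).hom hb).trans ?_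
  exact map_zero _

theorem epi_koszulD : Epi (koszulD x 0) := by
  refine epi_of_locally _ fun U b t ht ↦ ?_
  obtain ⟨V, hV, htV, i, hi⟩ := hloc U t ht
  exact ⟨V, hV, htV, exists_koszulD_zero_eq (x := x) (Φ := sectionsFunctor V) (i := i)
      (fun p ↦ (hi p).2) _⟩

theorem shortExact_koszulD_zero :
    (ShortComplex.mk (kernel.ι (koszulD x 0)) (koszulD x 0) (by simp)).ShortExact :=
  .mk' (ShortComplex.exact_kernel _) inferInstance (epi_koszulD x hloc)

include hx

theorem subsingleton_H_kernel_koszulD {k : ℕ}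
    (h : ∀ q, Subsingleton (Sheaf.H (G (2 + q)) (k + q))) :
    Subsingleton (Sheaf.H (kernel (koszulD x 0)) k) := by
  refine subsingleton_ext_kernel _ (koszulD x) (koszulD_comp_koszulD x hx)
    (exact_koszulD x hx hloc) (N := Fintype.card ι) (fun p hp ↦ isZero_koszulObj hp) 0 k fun q ↦ ?_
  refine subsingleton_ext_biproduct _ _ _ fun _ ↦ ?_
  rw [zero_add]
  exact h q

/-- If `H^(k+p-1)(G p) = 0` for all `p > 0`, then `Hᵏ(G 0) = 0`: the Koszul complex is a resolution
of zero whose terms are sums of copies of the sheaves `G p`. -/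
theorem subsingleton_H_of_koszul {k : ℕ}
    (h : ∀ q, Subsingleton (Sheaf.H (G (1 + q)) (k + q))) : Subsingleton (Sheaf.H (G 0) k) := by
  refine subsingleton_ext_of_retract _ (koszulι ι G 0 ∅) (koszulπ ι G 0 ∅) (koszulι_π_self rfl) k ?_
  refine subsingleton_ext_X₃ _ (shortExact_koszulD_zero x hloc)
    (subsingleton_ext_biproduct _ _ _ fun _ ↦ h 0)
    (subsingleton_H_kernel_koszulD x hx hloc fun q ↦ ?_)
  have := h (q + 1)
  rwa [show 1 + (q + 1) = 2 + q by ring, show k + (q + 1) = k + 1 + q by ring] at this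

/-- If `H^(p-1)(G p) = 0` for all `p > 1`, then the variables generate the global sections of
`G 0` from those of `G 1`. -/
theorem exists_sum_of_koszul (h : ∀ q, Subsingleton (Sheaf.H (G (2 + q)) (1 + q)))
    (b : (G 0).obj.obj (op ⊤)) : ∃ a : ι → (G 1).obj.obj (op ⊤),
      b = ∑ j, ((x j 0).hom.app (op ⊤)).hom (a j) := by
  obtain ⟨a, ha⟩ := exists_section_of_subsingleton_H (shortExact_koszulD_zero x hloc)
    (subsingleton_H_kernel_koszulD x hx hloc h) (((koszulι ι G 0 ∅).hom.app (op ⊤)).hom b)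
  have h1 := map_koszulD_π x (sectionsFunctor ⊤) 0 ∅ a
  refine ⟨fun j ↦ koszulSign j ∅ •
    ((koszulπ ι G 1 (insert j ∅)).hom.app (op ⊤)).hom a, ?_⟩
  have h2 := map_comp_hom_apply (sectionsFunctor ⊤) (koszulι ι G 0 ∅) (koszulπ ι G 0 ∅) b
  rw [koszulι_π_self (p := 0) (S := ∅) rfl, CategoryTheory.Functor.map_id] at h2
  refine h2.trans ((congrArg ((koszulπ ι G 0 ∅).hom.app (op ⊤)).hom ha.symm).trans (h1.trans ?_))
  rw [Finset.compl_empty]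
  exact Finset.sum_congr rfl fun j _ ↦ (map_zsmul _ _ _).symm

end Koszul

end Sheaves

/-! ### Twisted ideal sheaves on projective space -/

noncomputable section Fractions

variable {n : ℕ}

/-- The standard affine open set `D₊(xᵢ)` of `ℙⁿ`. -/
def stdOpen (n : ℕ) (i : Fin (n + 1)) : (PSpace n).affineOpens :=
  ⟨Proj.basicOpen (grading n) (MvPolynomial.X i),
    Proj.isAffineOpen_basicOpen (grading n) _ (MvPolynomial.isHomogeneous_X ℂ i) one_pos⟩

theorem mem_stdOpen {i : Fin (n + 1)} {x : PSpace n} :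
    x ∈ (stdOpen n i).1 ↔ MvPolynomial.X i ∉ primeOf x := Iff.rfl

theorem X_mem_grading (j : Fin (n + 1)) :
    (MvPolynomial.X j : MvPolynomial (Fin (n + 1)) ℂ) ∈ grading n 1 :=
  MvPolynomial.isHomogeneous_X ℂ j

/-- The open sets `D₊(xᵢ)` cover `ℙⁿ`. -/
theorem iSup_stdOpen (n : ℕ) : ⨆ i, (stdOpen n i).1 = ⊤ := by
  refine Proj.iSup_basicOpen_eq_top' (grading n) (fun i ↦ (MvPolynomial.X i))
    (fun i ↦ ⟨1, MvPolynomial.isHomogeneous_X ℂ i⟩) ?_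
  have h := MvPolynomial.adjoin_range_X (σ := Fin (n + 1)) (R := ℂ)
  rw [eq_top_iff]
  intro p _
  have hp : p ∈ Algebra.adjoin ℂ (Set.range (MvPolynomial.X : Fin (n + 1) → MvPolynomial _ ℂ)) :=
    h ▸ Algebra.mem_top
  induction hp using Algebra.adjoin_induction with
  | mem x hx => exact Algebra.subset_adjoin hx
  | algebraMap r =>
    have : algebraMap ℂ (MvPolynomial (Fin (n + 1)) ℂ) r =
      algebraMap (grading n 0) _ (algebraMap ℂ (grading n 0) r) := rfl
    rw [this]
    exact Subalgebra.algebraMap_mem _ _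
  | add x y _ _ hx hy => exact add_mem (hx trivial) (hy trivial)
  | mul x y _ _ hx hy => exact mul_mem (hx trivial) (hy trivial)

theorem exists_mem_stdOpen (x : PSpace n) : ∃ i, x ∈ (stdOpen n i).1 := by
  have : x ∈ ⨆ i, (stdOpen n i).1 := iSup_stdOpen n ▸ trivial
  simpa using this

theorem germAt_injective {V : (PSpace n).Opens} {f g : Γ(PSpace n, V)}
    (h : ∀ x (hx : x ∈ V), germAt x hx f = germAt x hx g) : f = g := by
  refine Subtype.ext (funext fun x ↦ ?_)
  exact HomogeneousLocalization.val_injective _ (h x.1 x.2)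

/-- The coordinate `xᵢ` as a unit of the localization at a point of `D₊(xᵢ)`. -/
def coordUnit (i : Fin (n + 1)) (x : PSpace n) (h : MvPolynomial.X i ∉ primeOf x) : (LocAt x)ˣ :=
  (IsLocalization.map_units (LocAt x) (⟨MvPolynomial.X i, h⟩ : (primeOf x).primeCompl)).unit

@[simp]
theorem coe_coordUnit (i : Fin (n + 1)) (x : PSpace n) (h : MvPolynomial.X i ∉ primeOf x) :
    (coordUnit i x h : LocAt x) = coord i x := rfl

/-- The regular function `a / xᵢᵏ` on `D₊(xᵢ)`, for a form `a` of degree `k`. -/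
def frac (i : Fin (n + 1)) {k : ℕ} (a : MvPolynomial (Fin (n + 1)) ℂ) (ha : a ∈ grading n k) :
    Γ(PSpace n, (stdOpen n i).1) :=
  (Proj.awayToSection (grading n) (MvPolynomial.X i)).hom
    (HomogeneousLocalization.Away.mk (grading n) (X_mem_grading i) k a (by simpa using ha))

theorem germAt_frac_mul (i : Fin (n + 1)) {k : ℕ} {a : MvPolynomial (Fin (n + 1)) ℂ}
    (ha : a ∈ grading n k) (x : PSpace n) (hx : x ∈ (stdOpen n i).1) :
    germAt x hx (frac i a ha) * coord i x ^ k = algebraMap _ (LocAt x) a := by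
  let z := HomogeneousLocalization.Away.mk (grading n) (X_mem_grading i) k a (by simpa using ha)
  have hz : z.val = _ := HomogeneousLocalization.Away.val_mk (grading n) k (X_mem_grading i) a
    (by simpa using ha)
  have h : germAt x hx (frac i a ha) = IsLocalization.map (M := Submonoid.powers (MvPolynomial.X i))
      (T := (primeOf x).primeCompl) (LocAt x) (RingHom.id _) (Submonoid.powers_le.mpr
          (mem_stdOpen.1 hx)) z.val :=
    ProjectiveSpectrum.Proj.awayToSection_apply (grading n) (MvPolynomial.X i) z ⟨x, hx⟩
  rw [h, hz, Localization.mk_eq_mk', IsLocalization.map_mk', ← map_pow]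
  exact IsLocalization.mk'_spec (LocAt x) (RingHom.id _ a) _

theorem exists_eq_frac (i : Fin (n + 1)) (f : Γ(PSpace n, (stdOpen n i).1)) :
    ∃ (k : ℕ) (a : MvPolynomial (Fin (n + 1)) ℂ) (ha : a ∈ grading n k), f = frac i a ha := by
  let e := Proj.basicOpenIsoAway (grading n) (MvPolynomial.X i)
    (MvPolynomial.isHomogeneous_X ℂ i) one_pos
  obtain ⟨k, a, ha, h⟩ := HomogeneousLocalization.Away.mk_surjective (𝒜 := grading n)
    (MvPolynomial.isHomogeneous_X ℂ i) (e.inv.hom f)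
  refine ⟨k, a, by simpa using ha, ?_⟩
  have h1 : e.hom.hom (e.inv.hom f) = f := ConcreteCategory.congr_hom e.inv_hom_id f
  rw [← h1, ← h]
  rfl

theorem germAt_frac (i : Fin (n + 1)) {k : ℕ} {a : MvPolynomial (Fin (n + 1)) ℂ}
    (ha : a ∈ grading n k) (x : PSpace n) (hx : x ∈ (stdOpen n i).1) :
    germAt x hx (frac i a ha) = algebraMap _ (LocAt x) a * ↑(coordUnit i x (mem_stdOpen.1 hx) ^
        (-(k : ℤ))) := by
  rw [← germAt_frac_mul i ha x hx, mul_assoc, zpow_neg, zpow_natCast, ← coe_coordUnit i x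
      (mem_stdOpen.1 hx),
    ← Units.val_pow_eq_pow_val, Units.mul_inv, mul_one]

end Fractions

noncomputable section TwistSections

variable {n : ℕ} {I : (PSpace n).IdealSheafData}

theorem mem_twistSections {d : ℤ} {U : (PSpace n).Opens} {s : ∀ x : U, LocAt x.1} :
    s ∈ twistSections I d U ↔ IsTwistSection I d s := Iff.rfl

theorem mul_pow_toNat_iff {R : Type*} [CommRing R] (u : Rˣ) (a b : R) (d : ℤ) :
    a * (u : R) ^ (-d).toNat = b * (u : R) ^ d.toNat ↔ a = b * ↑(u ^ d) := by
  obtain ⟨k, rfl | rfl⟩ := d.eq_nat_or_neg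
  · simp
  · rw [zpow_neg, Units.eq_mul_inv_iff_mul_eq]
    simp

/-- `IsTwistSection` in terms of integral powers of the unit `xᵢ`. -/
theorem isTwistSection_iff {d : ℤ} {U : (PSpace n).Opens} {s : ∀ x : U, LocAt x.1} :
    IsTwistSection I d s ↔ ∀ (i : Fin (n + 1)) (x : U), MvPolynomial.X i ∉ primeOf x.1 →
      ∃ (V : (PSpace n).affineOpens) (hVU : V.1 ≤ U), x.1 ∈ V.1 ∧ ∃ f ∈ I.ideal V,
        ∀ (y : PSpace n) (hy : y ∈ V.1), ∃ h : MvPolynomial.X i ∉ primeOf y,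
          s ⟨y, hVU hy⟩ = germAt y hy f * ↑(coordUnit i y h ^ d) := by
  simp only [IsTwistSection, ← mul_pow_toNat_iff, coe_coordUnit, exists_prop]

/-- A section of `I(d)` times functions `g * xᵢ ^ (e - d)` is a section of `I(e)`. -/
theorem IsTwistSection.of_mul {d e : ℤ} {U : (PSpace n).Opens} {s t : ∀ x : U, LocAt x.1}
    (hs : IsTwistSection I d s)
    (h : ∀ (i : Fin (n + 1)) (x : U), MvPolynomial.X i ∉ primeOf x.1 →
      ∃ (V : (PSpace n).Opens) (hVU : V ≤ U) (_ : x.1 ∈ V) (g : Γ(PSpace n, V)),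
        ∀ (y : PSpace n) (hy : y ∈ V) (hi : MvPolynomial.X i ∉ primeOf y),
          t ⟨y, hVU hy⟩ = germAt y hy g * s ⟨y, hVU hy⟩ * ↑(coordUnit i y hi ^ (e - d))) :
    IsTwistSection I e t := by
  rw [isTwistSection_iff] at hs ⊢
  intro i x hx
  obtain ⟨V, hVU, hxV, f, hf, hV⟩ := hs i x hx
  obtain ⟨W, hWU, hxW, g, hW⟩ := h i x hx
  obtain ⟨V', hxV', hV'⟩ := exists_affine_le (U := V.1 ⊓ W) ⟨hxV, hxW⟩
  refine ⟨V', (hV'.trans inf_le_left).trans hVU, hxV',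
    (PSpace n).presheaf.map (homOfLE (hV'.trans inf_le_right)).op g *
    (PSpace n).presheaf.map (homOfLE (hV'.trans inf_le_left)).op f,
    Ideal.mul_mem_left _ _ (I.ideal_le_comap_ideal (hV'.trans inf_le_left) hf), fun y hy ↦ ?_⟩
  obtain ⟨hi, hV⟩ := hV y (hV' hy).1
  refine ⟨hi, ?_⟩
  rw [hW y (hV' hy).2 hi, hV, map_mul, germAt_res, germAt_res, sub_eq_add_neg, add_comm e (-d),
      zpow_add,
    zpow_neg, Units.val_mul]
  have := Units.mul_inv (coordUnit i y hi ^ d)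
  linear_combination (germAt y (hV' hy).2 g * germAt y (hV' hy).1 f * ↑(coordUnit i y hi ^ e)) *
      this

/-- Multiplication by `xⱼ` on sections. -/
theorem IsTwistSection.coord_mul {d e : ℤ} (hde : e = d + 1) (j : Fin (n + 1))
    {U : (PSpace n).Opens} {s : ∀ x : U, LocAt x.1} (hs : IsTwistSection I d s) :
    IsTwistSection I e fun y ↦ coord j y.1 * s y := by
  refine hs.of_mul fun i x hx ↦ ⟨U ⊓ (stdOpen n i).1, inf_le_left, ⟨x.2, hx⟩,
    (PSpace n).presheaf.map (homOfLE inf_le_right).op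
      (frac i (MvPolynomial.X j) (X_mem_grading j)), fun y hy hi ↦ ?_⟩
  rw [germAt_res, germAt_frac, hde, add_sub_cancel_left, zpow_one, Nat.cast_one, zpow_neg_one]
  have := Units.inv_mul (coordUnit i y hi)
  linear_combination (-coord j y * s ⟨y, hy.1⟩) * this

/-- Division by `xᵢ` of sections over a subset of `D₊(xᵢ)`. -/
theorem IsTwistSection.coord_inv_mul {d e : ℤ} (hde : e = d + 1) (i : Fin (n + 1))
    {U : (PSpace n).Opens} (hU : U ≤ (stdOpen n i).1) {s : ∀ x : U, LocAt x.1}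
    (hs : IsTwistSection I e s) :
    IsTwistSection I d fun y ↦ ↑(coordUnit i y.1 (mem_stdOpen.1 (hU y.2)))⁻¹ * s y := by
  refine hs.of_mul fun j x hx ↦ ⟨U, le_rfl, x.2,
    (PSpace n).presheaf.map (homOfLE hU).op
      (frac i (MvPolynomial.X j) (X_mem_grading j)), fun y hy hi ↦ ?_⟩
  rw [germAt_res, germAt_frac, hde, sub_add_cancel_left, Nat.cast_one, zpow_neg_one, zpow_neg_one]
  have := Units.mul_inv (coordUnit j y hi)
  simp only [coe_coordUnit] at this
  linear_combination (-(↑(coordUnit i y (mem_stdOpen.1 (hU hy)))⁻¹ : LocAt y) * s ⟨y, hy⟩) * this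

/-- Multiplication by `xⱼ` as a morphism `I(d) ⟶ I(d + 1)`. -/
def mulCoord (I : (PSpace n).IdealSheafData) {d e : ℤ} (hde : e = d + 1) (j : Fin (n + 1)) :
    twist I d ⟶ twist I e :=
  ⟨{ app _ := AddCommGrpCat.ofHom
      { toFun s := ⟨fun y ↦ coord j y.1 * s.1 y, IsTwistSection.coord_mul hde j s.2⟩
        map_zero' := Subtype.ext (funext fun _ ↦ mul_zero _)
        map_add' _ _ := Subtype.ext (funext fun _ ↦ mul_add _ _ _) }
     naturality _ _ _ := rfl }⟩

theorem mulCoord_comm {d e e' : ℤ} (hde : e = d + 1) (hde' : e' = e + 1) (i j : Fin (n + 1)) :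
    mulCoord I hde i ≫ mulCoord I hde' j = mulCoord I hde j ≫ mulCoord I hde' i := by
  refine ObjectProperty.hom_ext _ ?_
  ext U s
  refine Subtype.ext (funext fun y ↦ ?_)
  exact mul_left_comm (coord j y.1) (coord i y.1) (s.1 y)

theorem bijective_mulCoord {d e : ℤ} (hde : e = d + 1) (i : Fin (n + 1)) {V : (PSpace n).Opens}
    (hV : V ≤ (stdOpen n i).1) :
    Function.Bijective ((mulCoord I hde i).hom.app (op V)).hom := by
  constructor
  · intro s t hst
    refine Subtype.ext (funext fun y ↦ ?_)
    have : coord i y.1 * s.1 y = coord i y.1 * t.1 y := congrFun (congrArg Subtype.val hst) y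
    exact (coordUnit i y.1 (hV y.2)).isUnit.mul_left_cancel this
  · intro t
    have ht : IsTwistSection I e t.1 := t.2
    refine ⟨(⟨_, mem_twistSections.2 (ht.coord_inv_mul hde i hV)⟩ : twistSections I d V), ?_⟩
    refine Subtype.ext (funext fun y ↦ ?_)
    exact Units.mul_inv_cancel_left (coordUnit i y.1 (mem_stdOpen.1 (hV y.2))) (t.1 y)

theorem mulCoord_locally_bijective (d : ℕ → ℤ) (hd : ∀ p, d p = d (p + 1) + 1)
    (U : (PSpace n).Opens) (x : PSpace n) (hx : x ∈ U) : ∃ V ≤ U, x ∈ V ∧ ∃ i, ∀ p,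
      Function.Bijective ((mulCoord I (hd p) i).hom.app (op V)).hom := by
  obtain ⟨i, hi⟩ := exists_mem_stdOpen x
  exact ⟨U ⊓ (stdOpen n i).1, inf_le_left, ⟨hx, hi⟩, i,
    fun p ↦ bijective_mulCoord (hd p) i inf_le_right⟩

/-- An `r`-regular ideal sheaf is `(r + 1)`-regular, by the Koszul complex of `x₀, …, xₙ` with terms
`I(r + 1 - i - p)`. -/
theorem IsRegular.succ {r : ℤ} (h : IsRegular I r) : IsRegular I (r + 1) := by
  intro i hi
  have := subsingleton_H_of_koszul (T := (PSpace n).toTopCat)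
    (G := fun p : ℕ ↦ twist I (r + 1 - i - p)) (k := i)
    (fun j p ↦ mulCoord I (by push_cast; ring) j)
    (fun _ _ _ ↦ mulCoord_comm _ _ _ _)
    (mulCoord_locally_bijective (fun p : ℕ ↦ r + 1 - i - p) (fun p ↦ by push_cast; ring))
        (fun q ↦ by
      have := h (i + q) (by omega)
      rwa [show r - (i + q : ℕ) = r + 1 - i - (1 + q : ℕ) by push_cast; ring] at this)
  simpa using this

/-- If `I` is `r`-regular, then the global sections of `I(r + 1)` are generated by those of `I(r)`
(Castelnuovo–Mumford). -/
theorem IsRegular.exists_sum {m e : ℤ} (h : IsRegular I m) (he : e = m + 1)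
    {s : ∀ x : (⊤ : (PSpace n).Opens), LocAt x.1} (hs : IsTwistSection I e s) :
    ∃ t : Fin (n + 1) → ∀ x : (⊤ : (PSpace n).Opens), LocAt x.1,
      (∀ j, IsTwistSection I m (t j)) ∧ ∀ x, s x = ∑ j, coord j x.1 * t j x := by
  subst he
  obtain ⟨a, ha⟩ := exists_sum_of_koszul (T := (PSpace n).toTopCat)
    (G := fun p : ℕ ↦ twist I (m + 1 - p))
    (fun j p ↦ mulCoord I (by push_cast; ring) j)
    (fun _ _ _ ↦ mulCoord_comm _ _ _ _)
    (mulCoord_locally_bijective (fun p : ℕ ↦ m + 1 - p) (fun p ↦ by push_cast; ring)) (fun q ↦ by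
      have := h (1 + q) (by omega)
      rwa [show m - (1 + q : ℕ) = m + 1 - (2 + q : ℕ) by push_cast; ring] at this)
    (⟨s, by rwa [Nat.cast_zero, sub_zero]⟩ : twistSections I (m + 1 - (0 : ℕ)) ⊤)
  have ha' : ∀ j, IsTwistSection I (m + 1 - (1 : ℕ)) (a j).1 := fun j ↦ (a j).2
  refine ⟨fun j ↦ (a j).1, fun j ↦ by simpa using ha' j, fun x ↦ ?_⟩
  let ev : twistSections I (m + 1 - (0 : ℕ)) ⊤ →+ LocAt x.1 :=
    (Pi.evalAddMonoidHom (fun x : (⊤ : (PSpace n).Opens) ↦ LocAt x.1) x).comp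
      (AddSubgroup.subtype _)
  refine (congrArg ev ha).trans ?_
  exact map_sum ev _ _

end TwistSections

/-! ### Extension of local sections -/

noncomputable section Extension

variable {n : ℕ} {I : (PSpace n).IdealSheafData}

/-- `germAt` is the germ in the stalk of `𝒪`, read in the localization. -/
theorem germAt_eq_stalk {V : (PSpace n).Opens} (x : PSpace n) (hx : x ∈ V) (f : Γ(PSpace n, V)) :
    germAt x hx f = algebraMap (HomogeneousLocalization.AtPrime (grading n) (primeOf x)) (LocAt x)
      (Proj.stalkIso' (grading n) x ((PSpace n).presheaf.germ V x hx f)) :=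
  congrArg _ (Proj.stalkIso'_germ (grading n) V x hx f).symm

theorem exists_res_eq_of_germAt_eq {V W : (PSpace n).Opens} {x : PSpace n} (hV : x ∈ V) (hW : x ∈ W)
    {f : Γ(PSpace n, V)} {g : Γ(PSpace n, W)} (h : germAt x hV f = germAt x hW g) :
    ∃ (U : (PSpace n).Opens) (hUV : U ≤ V) (hUW : U ≤ W), x ∈ U ∧
      (PSpace n).presheaf.map (homOfLE hUV).op f = (PSpace n).presheaf.map (homOfLE hUW).op g := by
  rw [germAt_eq_stalk, germAt_eq_stalk] at h
  have h' := (Proj.stalkIso' (grading n) x).injective (HomogeneousLocalization.val_injective _ h)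
  obtain ⟨U, hU, iV, iW, e⟩ := TopCat.Presheaf.germ_eq _ x hV hW f g h'
  exact ⟨U, iV.le, iW.le, hU, e⟩

theorem isUnit_germAt_of_mem_basicOpen {V : (PSpace n).Opens} {f : Γ(PSpace n, V)} {x : PSpace n}
    (hx : x ∈ V) (h : x ∈ (PSpace n).basicOpen f) : IsUnit (germAt x hx f) := by
  rw [germAt_eq_stalk]
  exact (((PSpace n).mem_basicOpen f x hx).1 h |>.map (Proj.stalkIso' (grading n) x)).map _

theorem notMem_of_isUnit_coord {i : Fin (n + 1)} {x : PSpace n} (h : IsUnit (coord i x)) :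
    MvPolynomial.X i ∉ primeOf x := by
  have := (IsLocalization.AtPrime.isUnit_to_map_iff (LocAt x) (primeOf x) (MvPolynomial.X i)).1 h
  exact this

theorem germAt_mul_coord_pow (j : Fin (n + 1)) {k N : ℕ} {a : MvPolynomial (Fin (n + 1)) ℂ}
    (ha : a ∈ grading n k) (i : Fin (n + 1)) (x : PSpace n) (hx : x ∈ (stdOpen n j).1) :
    germAt x hx (frac j (MvPolynomial.X i) (X_mem_grading i) ^ N * frac j a ha) *
      coord j x ^ (k + N) = algebraMap _ (LocAt x) (MvPolynomial.X i ^ N * a) := by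
  rw [map_mul, map_mul, map_pow, map_pow, ← germAt_frac_mul j ha x hx,
    ← germAt_frac_mul j (X_mem_grading i) x hx]
  ring

theorem exists_pow_mul_mem (P : Scheme.{0}) (I : P.IdealSheafData) (U : P.affineOpens)
    (t f : Γ(P, U)) (h : P.presheaf.map (homOfLE (P.basicOpen_le t)).op f ∈
      I.ideal (P.affineBasicOpen t)) : ∃ N : ℕ, t ^ N * f ∈ I.ideal U := by
  have inst := U.2.isLocalization_basicOpen t
  rw [← I.map_ideal_basicOpen U t] at h
  have h1 := IsLocalization.mk'_mem_map_algebraMap_iff (Submonoid.powers t) Γ(P, P.basicOpen t)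
    (I.ideal U) f 1
  rw [IsLocalization.mk'_one] at h1
  obtain ⟨_, ⟨N, rfl⟩, hN⟩ := h1.1 h
  exact ⟨N, hN⟩

/-- If `a / xᵢᵏ` is a section of `I` over `D₊(xᵢ)`, then `xᵢᴺ a / xⱼᵏ⁺ᴺ` is one over `D₊(xⱼ)`, for
large `N`. -/
theorem exists_frac_pow_mul_mem (i j : Fin (n + 1)) {k : ℕ} {a : MvPolynomial (Fin (n + 1)) ℂ}
    (ha : a ∈ grading n k) (h : frac i a ha ∈ I.ideal (stdOpen n i)) :
    ∃ N : ℕ, frac j (MvPolynomial.X i) (X_mem_grading i) ^ N * frac j a ha ∈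
      I.ideal (stdOpen n j) := by
  -- The function `t = xᵢ / xⱼ` on `D₊(xⱼ)` cuts out the intersection with `D₊(xᵢ)`.
  let t := frac j (MvPolynomial.X i) (X_mem_grading i)
  have hW : (PSpace n).basicOpen t ≤ (stdOpen n i).1 := by
    intro y hy
    have hyj : y ∈ (stdOpen n j).1 := (PSpace n).basicOpen_le t hy
    refine notMem_of_isUnit_coord ?_
    have e := germAt_frac_mul j (X_mem_grading i) y hyj
    rw [pow_one] at e
    rw [coord, ← e]
    exact (isUnit_germAt_of_mem_basicOpen hyj hy).mul (coordUnit j y (mem_stdOpen.1 hyj)).isUnit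
  refine exists_pow_mul_mem (PSpace n) I (stdOpen n j) t (frac j a ha) ?_
  have h1 := I.ideal_le_comap_ideal (U := (PSpace n).affineBasicOpen t) (V := stdOpen n i) hW h
  have h2 : (PSpace n).presheaf.map (homOfLE ((PSpace n).basicOpen_le t)).op (frac j a ha) =
      (PSpace n).presheaf.map (homOfLE ((PSpace n).basicOpen_le t)).op t ^ k *
        (PSpace n).presheaf.map (homOfLE hW).op (frac i a ha) := by
    refine germAt_injective fun y hy ↦ ?_
    rw [map_mul, map_pow, germAt_res, germAt_res, germAt_res]
    have hyj : y ∈ (stdOpen n j).1 := (PSpace n).basicOpen_le t hy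
    refine ((coordUnit j y (mem_stdOpen.1 hyj)).isUnit.pow k).mul_right_cancel ?_
    rw [coe_coordUnit, germAt_frac_mul, mul_right_comm, ← mul_pow]
    have := germAt_frac_mul j (X_mem_grading i) y hyj
    rw [pow_one] at this
    rw [this, mul_comm]
    exact (germAt_frac_mul i ha y (hW hy)).symm
  rw [h2]
  exact Ideal.mul_mem_left _ _ h1

/-- A section of `I` over `D₊(xᵢ)` becomes a global section of `I(k)` after multiplication by a high
power `xᵢᵏ`; the global section is given by a polynomial `a`. -/
theorem exists_global_section (i : Fin (n + 1)) {f : Γ(PSpace n, (stdOpen n i).1)}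
    (hf : f ∈ I.ideal (stdOpen n i)) (K : ℕ) :
    ∃ k, K ≤ k ∧ ∃ a : MvPolynomial (Fin (n + 1)) ℂ,
      IsTwistSection I k (U := ⊤) (fun x ↦ algebraMap _ (LocAt x.1) a) ∧
      ∀ x (hx : x ∈ (stdOpen n i).1), algebraMap _ (LocAt x) a = germAt x hx f * coord i x ^ k := by
  obtain ⟨m, b, hb, rfl⟩ := exists_eq_frac i f
  choose N hN using fun j ↦ exists_frac_pow_mul_mem i j hb hf
  let M := Finset.univ.sup N ⊔ K
  have hM : ∀ j, frac j (MvPolynomial.X i) (X_mem_grading i) ^ M * frac j b hb ∈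
      I.ideal (stdOpen n j) := by
    intro j
    have hj : N j ≤ M := (Finset.le_sup (Finset.mem_univ j)).trans le_sup_left
    obtain ⟨q, hq⟩ := Nat.exists_eq_add_of_le' hj
    rw [hq, pow_add, mul_assoc]
    exact Ideal.mul_mem_left _ _ (hN j)
  refine ⟨m + M, le_sup_right.trans (Nat.le_add_left _ _), MvPolynomial.X i ^ M * b, ?_, fun x hx ↦
      ?_⟩
  · rw [isTwistSection_iff]
    intro j x hx
    refine ⟨stdOpen n j, le_top, mem_stdOpen.2 hx, _, hM j, fun y hy ↦ ⟨mem_stdOpen.1 hy, ?_⟩⟩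
    rw [zpow_natCast, Units.val_pow_eq_pow_val, coe_coordUnit]
    exact (germAt_mul_coord_pow j hb i y hy).symm
  · rw [map_mul, map_pow, ← germAt_frac_mul i hb x hx]
    ring

end Extension

/-! ### Constant functions and the Nullstellensatz -/

noncomputable section Nullstellensatz

variable {n : ℕ}

theorem eval₂_mul_right_of_isHomogeneous {σ R S : Type*} [Fintype σ] [CommRing R] [CommRing S]
    (f : R →+* S) (v : σ → S) (w : S) {k : ℕ} {a : MvPolynomial σ R} (ha : a.IsHomogeneous k) :
    MvPolynomial.eval₂ f (fun j ↦ v j * w) a = MvPolynomial.eval₂ f v a * w ^ k := by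
  rw [MvPolynomial.eval₂_eq', MvPolynomial.eval₂_eq', Finset.sum_mul]
  refine Finset.sum_congr rfl fun d hd ↦ ?_
  have : ∑ j, d j = k := by
    rw [ha.degree_eq_sum_deg_support hd]
    exact (Finset.sum_subset (Finset.subset_univ _) fun j _ hj ↦ by simpa using hj).symm
  rw [← this, ← Finset.prod_pow_eq_pow_sum, mul_assoc, ← Finset.prod_mul_distrib]
  simp only [mul_pow]

/-- The constant functions on `D₊(xᵢ)`. -/
def constFun (i : Fin (n + 1)) : ℂ →+* Γ(PSpace n, (stdOpen n i).1) :=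
  (Proj.awayToSection (grading n) (MvPolynomial.X i)).hom.comp
    ((HomogeneousLocalization.fromZeroRingHom (grading n) _).comp (algebraMap ℂ (grading n 0)))

theorem germAt_constFun (i : Fin (n + 1)) (c : ℂ) (x : PSpace n) (hx : x ∈ (stdOpen n i).1) :
    germAt x hx (constFun i c) = algebraMap ℂ (LocAt x) c := by
  let z : HomogeneousLocalization.Away (grading n) (MvPolynomial.X i) :=
    HomogeneousLocalization.fromZeroRingHom (grading n) _ (algebraMap ℂ (grading n 0) c)
  have hz : z.val = Localization.mk (algebraMap ℂ (MvPolynomial (Fin (n + 1)) ℂ) c) 1 := rfl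
  have h : germAt x hx (constFun i c) = IsLocalization.map (M := Submonoid.powers
      (MvPolynomial.X i))
      (T := (primeOf x).primeCompl) (LocAt x) (RingHom.id _)
      (Submonoid.powers_le.mpr (mem_stdOpen.1 hx)) z.val :=
    ProjectiveSpectrum.Proj.awayToSection_apply (grading n) (MvPolynomial.X i) z ⟨x, hx⟩
  rw [h, hz, Localization.mk_one_eq_algebraMap, IsLocalization.map_eq]
  rfl

/-- The functions on `D₊(xᵢ)` are polynomials in the `xⱼ / xᵢ`. -/
theorem exists_eval₂_eq (i : Fin (n + 1)) (f : Γ(PSpace n, (stdOpen n i).1)) :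
    ∃ a, MvPolynomial.eval₂Hom (constFun i) (fun j ↦ frac i (MvPolynomial.X j) (X_mem_grading j)) a
      = f := by
  obtain ⟨k, a, ha, rfl⟩ := exists_eq_frac i f
  refine ⟨a, germAt_injective fun x hx ↦ ?_⟩
  refine ((coordUnit i x (mem_stdOpen.1 hx)).isUnit.pow k).mul_right_cancel ?_
  rw [coe_coordUnit, germAt_frac_mul, MvPolynomial.coe_eval₂Hom, MvPolynomial.hom_eval₂,
    ← eval₂_mul_right_of_isHomogeneous _ _ _ ha]
  have h1 : (germAt x hx).comp (constFun i) = (algebraMap _ (LocAt x)).comp MvPolynomial.C :=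
    RingHom.ext fun c ↦ germAt_constFun i c x hx
  have h2 : ∀ j, germAt x hx (frac i (MvPolynomial.X j) (X_mem_grading j)) * coord i x =
      algebraMap _ (LocAt x) (MvPolynomial.X j) := fun j ↦ by
    simpa using germAt_frac_mul i (X_mem_grading j) x hx
  simp only [h1, h2]
  rw [← MvPolynomial.hom_eval₂, MvPolynomial.eval₂_eta]

/-- By the Nullstellensatz, functions on `D₊(xᵢ)` are constant modulo a maximal ideal. -/
theorem exists_sub_constFun_mem (i : Fin (n + 1)) (m : Ideal Γ(PSpace n, (stdOpen n i).1))
    (hm : m.IsMaximal) (f : Γ(PSpace n, (stdOpen n i).1)) : ∃ c : ℂ, f - constFun i c ∈ m := by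
  let φ := MvPolynomial.eval₂Hom (constFun i)
    (fun j : Fin (n + 1) ↦ frac i (MvPolynomial.X j) (X_mem_grading j))
  have hφ : Function.Surjective φ := exists_eval₂_eq i
  have hmax : (m.comap φ).IsMaximal := Ideal.comap_isMaximal_of_surjective φ hφ
  obtain ⟨z, hz⟩ := MvPolynomial.isMaximal_iff_eq_vanishingIdeal_singleton.1 hmax
  obtain ⟨a, rfl⟩ := hφ f
  refine ⟨MvPolynomial.eval z a, ?_⟩
  have : a - MvPolynomial.C (MvPolynomial.eval z a) ∈ m.comap φ := by
    rw [hz, MvPolynomial.mem_vanishingIdeal_singleton_iff]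
    simp
  simpa [φ] using this

end Nullstellensatz

/-! ### Stalks of twisted ideal sheaves -/

noncomputable section Point

variable {n : ℕ} (I J : (PSpace n).IdealSheafData) (d : ℤ) (p : PSpace n)

theorem isTwistSection_smul {I : (PSpace n).IdealSheafData} {d : ℤ} {U : (PSpace n).Opens}
    {s : ∀ x : U, LocAt x.1} (hs : IsTwistSection I d s) (c : ℂ) :
    IsTwistSection I d fun x ↦ c • s x := by
  refine hs.of_mul fun i x hx ↦ ⟨U ⊓ (stdOpen n i).1, inf_le_left, ⟨x.2, hx⟩,
    (PSpace n).presheaf.map (homOfLE inf_le_right).op (constFun i c), fun y hy hi ↦ ?_⟩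
  rw [germAt_res, germAt_constFun, Algebra.smul_def]
  simp

/-- A section of `I` over a subset of `D₊(xᵢ)`, times `xᵢ ^ d`, is a section of `I(d)`. -/
theorem isTwistSection_germAt_mul {I : (PSpace n).IdealSheafData} (d : ℤ) (i : Fin (n + 1))
    {V : (PSpace n).affineOpens} (hV : V.1 ≤ (stdOpen n i).1) {f : Γ(PSpace n, V.1)}
    (hf : f ∈ I.ideal V) :
    IsTwistSection I d fun x : V.1 ↦
      germAt x.1 x.2 f * ↑(coordUnit i x.1 (mem_stdOpen.1 (hV x.2)) ^ d) := by
  have h0 : IsTwistSection I 0 fun x : V.1 ↦ germAt x.1 x.2 f := by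
    rw [isTwistSection_iff]
    intro j x hx
    obtain ⟨W, hxW, hW⟩ := exists_affine_le (U := V.1 ⊓ (stdOpen n j).1) ⟨x.2, hx⟩
    refine ⟨W, hW.trans inf_le_left, hxW, _, I.ideal_le_comap_ideal (hW.trans inf_le_left) hf,
      fun y hy ↦ ⟨mem_stdOpen.1 (hW hy).2, ?_⟩⟩
    rw [zpow_zero, Units.val_one, mul_one]
    rfl
  refine h0.of_mul fun j x hx ↦ ?_
  obtain ⟨k, rfl | rfl⟩ := d.eq_nat_or_neg
  · refine ⟨V.1 ⊓ (stdOpen n j).1, inf_le_left, ⟨x.2, hx⟩,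
      (PSpace n).presheaf.map (homOfLE inf_le_right).op
        (frac j (MvPolynomial.X i) (X_mem_grading i)) ^ k, fun y hy hj ↦ ?_⟩
    have := germAt_frac_mul j (X_mem_grading i) y hy.2
    rw [pow_one] at this
    rw [map_pow, germAt_res, sub_zero, zpow_natCast, zpow_natCast, Units.val_pow_eq_pow_val,
      Units.val_pow_eq_pow_val, coe_coordUnit, coe_coordUnit, coord, ← this]
    ring
  · refine ⟨V.1, le_rfl, x.2, (PSpace n).presheaf.map (homOfLE hV).op
        (frac i (MvPolynomial.X j) (X_mem_grading j)) ^ k, fun y hy hj ↦ ?_⟩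
    have h1 := germAt_frac i (X_mem_grading j) y (hV hy)
    have h2 := Units.mul_inv (coordUnit j y hj)
    rw [Nat.cast_one, zpow_neg_one] at h1
    rw [map_pow, germAt_res, h1, sub_zero, zpow_neg, zpow_neg, zpow_natCast, zpow_natCast,
      ← inv_pow, ← inv_pow, Units.val_pow_eq_pow_val, Units.val_pow_eq_pow_val, mul_pow,
      mul_right_comm _ _ ((↑(coordUnit j y hj)⁻¹ : LocAt y) ^ k),
      mul_right_comm _ _ ((↑(coordUnit j y hj)⁻¹ : LocAt y) ^ k), ← mul_pow, ← coord,
      ← coe_coordUnit j y hj, h2]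
    ring

theorem isTwistSection_res {I : (PSpace n).IdealSheafData} {d : ℤ} {U V : (PSpace n).Opens}
    (h : V ≤ U) {s : ∀ x : U, LocAt x.1} (hs : IsTwistSection I d s) :
    IsTwistSection I d fun x : V ↦ s ⟨x.1, h x.2⟩ :=
  (twistPredicate I d).res (homOfLE h) s hs

/-- The stalk of `I(d)` at the point `p`, as a subspace of the localization at `p`. -/
def stalkTwist : Submodule ℂ (LocAt p) where
  carrier := {v | ∃ (U : (PSpace n).Opens) (hp : p ∈ U) (s : ∀ x : U, LocAt x.1),
    IsTwistSection I d s ∧ s ⟨p, hp⟩ = v}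
  zero_mem' := ⟨⊤, trivial, 0, zero_mem (twistSections I d ⊤), rfl⟩
  add_mem' := by
    rintro _ _ ⟨U, hU, s, hs, rfl⟩ ⟨V, hV, t, ht, rfl⟩
    exact ⟨U ⊓ V, ⟨hU, hV⟩, _, add_mem (S := AddSubgroup _)
      (mem_twistSections.2 (isTwistSection_res inf_le_left hs))
      (mem_twistSections.2 (isTwistSection_res inf_le_right ht)), rfl⟩
  smul_mem' := by
    rintro c _ ⟨U, hU, s, hs, rfl⟩
    exact ⟨U, hU, _, isTwistSection_smul hs c, rfl⟩

/-- The values at the point `p` of the global sections of `I(d)`. -/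
def globalTwist : Submodule ℂ (LocAt p) where
  carrier := {v | ∃ s : ∀ x : (⊤ : (PSpace n).Opens), LocAt x.1,
    IsTwistSection I d s ∧ s ⟨p, trivial⟩ = v}
  zero_mem' := ⟨0, zero_mem (twistSections I d ⊤), rfl⟩
  add_mem' := by
    rintro _ _ ⟨s, hs, rfl⟩ ⟨t, ht, rfl⟩
    exact ⟨_, add_mem (S := AddSubgroup _) (mem_twistSections.2 hs) (mem_twistSections.2 ht), rfl⟩
  smul_mem' := by
    rintro c _ ⟨s, hs, rfl⟩
    exact ⟨_, isTwistSection_smul hs c, rfl⟩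

variable {I J d p}

theorem IsTwistSection.mem_stalkTwist {U : (PSpace n).Opens} {s : ∀ x : U, LocAt x.1}
    (hs : IsTwistSection I d s) (hp : p ∈ U) : s ⟨p, hp⟩ ∈ stalkTwist I d p := ⟨U, hp, s, hs, rfl⟩

theorem IsTwistSection.mono (hIJ : I ≤ J) {U : (PSpace n).Opens} {s : ∀ x : U, LocAt x.1}
    (hs : IsTwistSection I d s) : IsTwistSection J d s := by
  intro i x hx
  obtain ⟨V, hVU, hxV, f, hf, h⟩ := hs i x hx
  exact ⟨V, hVU, hxV, f, hIJ V hf, h⟩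

theorem coord_mul_mem_stalkTwist {e : ℤ} (hde : e = d + 1) (j : Fin (n + 1)) {v : LocAt p}
    (hv : v ∈ stalkTwist I d p) : coord j p * v ∈ stalkTwist I e p := by
  obtain ⟨U, hU, s, hs, rfl⟩ := hv
  exact (hs.coord_mul hde j).mem_stalkTwist hU

theorem coord_zpow_mul_mem_stalkTwist {e k : ℤ} (hde : e = d + k) (i : Fin (n + 1))
    (hi : MvPolynomial.X i ∉ primeOf p) {v : LocAt p} (hv : v ∈ stalkTwist I d p) :
    ↑(coordUnit i p hi ^ k) * v ∈ stalkTwist I e p := by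
  have hinv : ∀ {d e : ℤ} (_ : e = d + 1) {v : LocAt p}, v ∈ stalkTwist I e p →
      ↑(coordUnit i p hi)⁻¹ * v ∈ stalkTwist I d p := by
    rintro d e hde _ ⟨U, hU, s, hs, rfl⟩
    exact ((isTwistSection_res (V := U ⊓ (stdOpen n i).1) inf_le_left hs).coord_inv_mul hde i
      inf_le_right).mem_stalkTwist ⟨hU, mem_stdOpen.2 hi⟩
  subst hde
  induction k with
  | zero => simpa using hv
  | succ k ih =>
    rw [zpow_add_one, mul_comm (coordUnit i p hi ^ (k : ℤ)), Units.val_mul, mul_assoc]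
    exact coord_mul_mem_stalkTwist (by ring) i ih
  | pred k ih =>
    rw [zpow_sub_one, mul_comm (coordUnit i p hi ^ (-k : ℤ)), Units.val_mul, mul_assoc]
    exact hinv (by ring) ih

/-- Multiplication by a function from an ideal sheaf `𝔪` takes the stalk of `J(d)` to that
of `(𝔪 J)(d)`. -/
theorem germAt_mul_mem_stalkTwist {m : (PSpace n).IdealSheafData} (hm : m * J ≤ I)
    {W : (PSpace n).affineOpens} (hp : p ∈ W.1) {g : Γ(PSpace n, W.1)} (hg : g ∈ m.ideal W)
    {v : LocAt p} (hv : v ∈ stalkTwist J d p) : germAt p hp g * v ∈ stalkTwist I d p := by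
  obtain ⟨U, hU, s, hs, rfl⟩ := hv
  obtain ⟨i, hi⟩ := exists_mem_stdOpen p
  rw [isTwistSection_iff] at hs
  obtain ⟨V, hVU, hxV, f, hf, h⟩ := hs i ⟨p, hU⟩ (mem_stdOpen.1 hi)
  obtain ⟨V', hxV', hV'⟩ := exists_affine_le (U := V.1 ⊓ W.1 ⊓ (stdOpen n i).1) ⟨⟨hxV, hp⟩, hi⟩
  have hV1 : V'.1 ≤ V.1 := fun x hx ↦ (hV' hx).1.1
  have hV2 : V'.1 ≤ W.1 := fun x hx ↦ (hV' hx).1.2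
  have h1 := isTwistSection_germAt_mul (I := I) d i (V := V') (fun x hx ↦ (hV' hx).2)
    (hm V' (Ideal.mul_mem_mul (m.ideal_le_comap_ideal hV2 hg) (J.ideal_le_comap_ideal hV1 hf)))
  have h2 := h1.mem_stalkTwist hxV'
  obtain ⟨_, h3⟩ := h p hxV
  rw [h3, ← mul_assoc]
  rw [map_mul] at h2
  exact h2

end Point

/-! ### Generation by global sections at a point -/

noncomputable section Generation

variable {n : ℕ} {I J m : (PSpace n).IdealSheafData} {p : PSpace n}

theorem IsRegular.of_le {r : ℤ} (h : IsRegular J r) (q : ℕ) : IsRegular J (r + q) := by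
  induction q with
  | zero => simpa using h
  | succ q ih => simpa [add_assoc] using ih.succ

/-- Modulo the stalk of `I(d + 1)`, the variable `xⱼ` acts on the stalk of `J(d)` at `p` as a
complex multiple of `xᵢ`, since the function `xⱼ / xᵢ` is constant modulo the maximal ideal of `p`.
-/
theorem exists_coord_sub_smul_mem (hm : m * J ≤ I) {i : Fin (n + 1)} (hi : p ∈ (stdOpen n i).1)
    (hmax : (m.ideal (stdOpen n i)).IsMaximal) (j : Fin (n + 1)) :
    ∃ c : ℂ, ∀ {d e : ℤ} (_ : e = d + 1) {v : LocAt p}, v ∈ stalkTwist J d p →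
      coord j p * v - c • (coord i p * v) ∈ stalkTwist I e p := by
  obtain ⟨c, hc⟩ := exists_sub_constFun_mem i _ hmax (frac i (MvPolynomial.X j) (X_mem_grading j))
  refine ⟨c, fun {d e} hde v hv ↦ ?_⟩
  have h1 := coord_mul_mem_stalkTwist hde i (germAt_mul_mem_stalkTwist hm hi hc hv)
  have h2 := germAt_frac_mul i (X_mem_grading j) p hi
  rw [pow_one] at h2
  rw [map_sub, germAt_constFun] at h1
  rw [Algebra.smul_def, coord, ← h2]
  convert h1 using 1
  ring

/-- If `J` is `r`-regular, then the global sections of `J(r + q)` are, at `p` and modulo the stalk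
of `I(r + q)`, the products of global sections of `J(r)` with `xᵢ ^ q`. -/
theorem exists_sub_coord_pow_mul_mem (hm : m * J ≤ I) {i : Fin (n + 1)} (hi : p ∈ (stdOpen n i).1)
    (hmax : (m.ideal (stdOpen n i)).IsMaximal) {r : ℤ} (hr : IsRegular J r) (q : ℕ) {e : ℤ}
    (he : e = r + q) {v : LocAt p} (hv : v ∈ globalTwist J e p) :
    ∃ w ∈ globalTwist J r p, v - coord i p ^ q * w ∈ stalkTwist I e p := by
  induction q generalizing e v with
  | zero =>
    obtain rfl : e = r := by simpa using he
    exact ⟨v, hv, by simp⟩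
  | succ q ih =>
    obtain ⟨s, hs, rfl⟩ := hv
    obtain ⟨t, ht, hst⟩ := (hr.of_le q).exists_sum (by rw [he]; push_cast; ring) hs
    have hde : e = r + q + 1 := by rw [he]; push_cast; ring
    choose w hw hw' using fun j ↦ ih rfl (v := t j ⟨p, trivial⟩) ⟨t j, ht j, rfl⟩
    choose c hc using exists_coord_sub_smul_mem hm hi hmax
    refine ⟨∑ j, c j • w j, Submodule.sum_mem _ fun j _ ↦ Submodule.smul_mem _ _ (hw j), ?_⟩
    rw [hst, Finset.mul_sum, ← Finset.sum_sub_distrib]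
    refine Submodule.sum_mem _ fun j _ ↦ ?_
    have h1 := hc j hde ((ht j).mem_stalkTwist (p := p) trivial)
    have h2 := Submodule.smul_mem _ (c j) (coord_mul_mem_stalkTwist hde i (hw' j))
    convert add_mem h1 h2 using 1
    simp only [Algebra.smul_def]
    ring

/-- If `J` is `r`-regular, then `J(r)` is generated by its global sections at a point `p`, modulo
an ideal sheaf that contains the product of `J` with the maximal ideal of `p`. -/
theorem stalkTwist_le_globalTwist_sup (hm : m * J ≤ I) {i : Fin (n + 1)}
    (hi : p ∈ (stdOpen n i).1) (hmax : (m.ideal (stdOpen n i)).IsMaximal) {r : ℤ}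
    (hr : IsRegular J r) : stalkTwist J r p ≤ globalTwist J r p ⊔ stalkTwist I r p := by
  have hi' := mem_stdOpen.1 hi
  -- A section `f` of `J` over the whole of `D₊(xᵢ)` becomes global in a high twist; the powers of
  -- `xᵢ` can be divided out again at `p`.
  have key : ∀ f ∈ J.ideal (stdOpen n i), germAt p hi f * ↑(coordUnit i p hi' ^ r) ∈
      globalTwist J r p ⊔ stalkTwist I r p := by
    intro f hf
    obtain ⟨k, hk, a, ha, haf⟩ := exists_global_section i hf r.toNat
    obtain ⟨q, hq⟩ := Int.eq_ofNat_of_zero_le (a := k - r) (by omega)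
    obtain ⟨w, hw, hw'⟩ := exists_sub_coord_pow_mul_mem hm hi hmax hr q (e := k) (by omega)
      (v := algebraMap _ (LocAt p) a) ⟨_, ha, rfl⟩
    have h1 := coord_zpow_mul_mem_stalkTwist (k := -q) (e := r) (by omega) i hi' hw'
    rw [haf p hi] at h1
    have h2 : germAt p hi f * ↑(coordUnit i p hi' ^ r) =
        w + ↑(coordUnit i p hi' ^ (-q : ℤ)) *
          (germAt p hi f * coord i p ^ k - coord i p ^ q * w) := by
      have e1 : (↑(coordUnit i p hi' ^ (-q : ℤ)) : LocAt p) * coord i p ^ q = 1 := by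
        rw [zpow_neg, zpow_natCast, ← coe_coordUnit i p hi', ← Units.val_pow_eq_pow_val,
          Units.inv_mul]
      have e2 : (↑(coordUnit i p hi' ^ (-q : ℤ)) : LocAt p) * coord i p ^ k =
          ↑(coordUnit i p hi' ^ r) := by
        rw [← coe_coordUnit i p hi', ← Units.val_pow_eq_pow_val, ← zpow_natCast, ← Units.val_mul,
          ← zpow_add]
        congr 2
        omega
      linear_combination w * e1 - germAt p hi f * e2
    rw [h2]
    exact Submodule.add_mem_sup hw h1
  -- A function `g` that is a unit at `p` is a constant `c` modulo `m`. One can divide by `c` if it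
  -- is not zero; if it is, then `g * w` lies in the stalk of `I(r)`, and so does `w`.
  have div : ∀ (g : Γ(PSpace n, (stdOpen n i).1)), p ∈ (PSpace n).basicOpen g → ∀ w ∈ stalkTwist J
      r p,
      germAt p hi g * w ∈ globalTwist J r p ⊔ stalkTwist I r p →
        w ∈ globalTwist J r p ⊔ stalkTwist I r p := by
    intro g hg w hw hgw
    obtain ⟨c, hc⟩ := exists_sub_constFun_mem i _ hmax g
    have h1 := germAt_mul_mem_stalkTwist hm hi hc hw
    rw [map_sub, germAt_constFun, sub_mul, ← Algebra.smul_def] at h1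
    by_cases h0 : c = 0
    · rw [h0, zero_smul, sub_zero] at h1
      have inst := (stdOpen n i).2.isLocalization_basicOpen g
      obtain ⟨h, hh⟩ := (IsLocalization.Away.algebraMap_isUnit
          (S := Γ(PSpace n, (PSpace n).basicOpen g))
        g).exists_left_inv
      have h2 := germAt_mul_mem_stalkTwist (I := I) (J := I) (m := ⊤) (by simp)
        (W := (PSpace n).affineBasicOpen g) (p := p) hg (g := h) trivial h1
      refine Submodule.mem_sup_right ?_
      have h3 : germAt p hg h * germAt p hi g = 1 :=
        (map_mul (germAt p hg) h _).symm.trans ((congrArg (germAt p hg) hh).trans (map_one _))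
      rw [← one_mul w, ← h3, mul_assoc]
      exact h2
    · rw [← inv_smul_smul₀ h0 w]
      refine Submodule.smul_mem _ _ ?_
      have := sub_mem hgw (Submodule.mem_sup_right h1)
      rwa [sub_sub_cancel] at this
  -- A section of `J` near `p` is a fraction `f₁ / g ^ N`, with `f₁` a section over `D₊(xᵢ)`.
  rintro _ ⟨U, hU, s, hs, rfl⟩
  have hs' := hs
  rw [isTwistSection_iff] at hs
  obtain ⟨V, hVU, hxV, f, hf, hV⟩ := hs i ⟨p, hU⟩ hi'
  obtain ⟨g, hgV, hpg⟩ := (stdOpen n i).2.exists_basicOpen_le ⟨p, hxV⟩ hi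
  have hfW := J.ideal_le_comap_ideal (U := (PSpace n).affineBasicOpen g) (V := V) hgV hf
  have inst := (stdOpen n i).2.isLocalization_basicOpen g
  have hfW' : (PSpace n).presheaf.map (homOfLE hgV).op f ∈
    J.ideal ((PSpace n).affineBasicOpen g) := hfW
  rw [← J.map_ideal_basicOpen (stdOpen n i) g] at hfW'
  obtain ⟨⟨⟨f₁, hf₁⟩, ⟨_, N, rfl⟩⟩, h1⟩ :=
    (IsLocalization.mem_map_algebraMap_iff (Submonoid.powers g)
        Γ(PSpace n, (PSpace n).basicOpen g)).1 hfW'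
  have h2 := congrArg (germAt p hpg) h1
  have h3 : germAt p hxV f * germAt p hi g ^ N = germAt p hi f₁ := by
    rw [map_mul] at h2
    refine Eq.trans ?_ h2
    rw [← map_pow]
    rfl
  have hpow : ∀ k, germAt p hi g ^ k * s ⟨p, hU⟩ ∈ stalkTwist J r p := fun k ↦ by
    rw [← map_pow]
    exact germAt_mul_mem_stalkTwist (I := J) (m := ⊤) (by simp) hi trivial (hs'.mem_stalkTwist hU)
  have hN : ∀ k ≤ N, germAt p hi g ^ (N - k) * s ⟨p, hU⟩ ∈ globalTwist J r p ⊔ stalkTwist I r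
      p := by
    intro k
    induction k with
    | zero =>
      intro _
      obtain ⟨_, h4⟩ := hV p hxV
      rw [Nat.sub_zero, h4, ← mul_assoc, mul_comm (_ ^ N), h3]
      exact key f₁ hf₁
    | succ k ih =>
      intro hk
      refine div g hpg _ (hpow _) ?_
      rw [← mul_assoc, ← pow_succ', show N - (k + 1) + 1 = N - k by omega]
      exact ih (by omega)
  simpa using hN N le_rfl

end Generation

/-! ### Skyscraper sheaves -/

noncomputable section Skyscraper

variable {T : TopCat.{0}}

open scoped Classical in
/-- The skyscraper sheaf at `p` with group `G`. -/
def skyscraper (p : T) (G : AddCommGrpCat.{0}) : AbSheaf T := skyscraperSheaf p G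

/-- The skyscraper functor is right adjoint to the exact functor of stalks, so it preserves
injective objects. -/
theorem injective_skyscraper (p : T) (G : AddCommGrpCat.{0}) [Injective G] :
    Injective (skyscraper p G) := by
  classical
  have : (TopCat.Sheaf.forget AddCommGrpCat.{0} T ⋙
    TopCat.Presheaf.stalkFunctor AddCommGrpCat.{0} p).PreservesMonomorphisms := inferInstance
  exact (stalkSkyscraperSheafAdjunction (C := AddCommGrpCat.{0}) p).map_injective G inferInstance

variable {p : T} {G : AddCommGrpCat.{0}}

theorem skyscraper_obj {U : Opens T} (h : p ∈ U) : (skyscraper p G).obj.obj (op U) = G := if_pos h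

/-- A skyscraper sheaf has no nonzero sections over an open set that does not contain the point. -/
def isTerminalSkyscraperObj {U : Opens T} (h : p ∉ U) :
    IsTerminal ((skyscraper p G).obj.obj (op U)) :=
  (if_neg h).symm.ndrec terminalIsTerminal

theorem skyscraper_map {U V : Opens T} (i : op U ⟶ op V) (hU : p ∈ U) (hV : p ∈ V) :
    (skyscraper p G).obj.map i =
      eqToHom (skyscraper_obj hU) ≫ eqToHom (skyscraper_obj hV).symm := by
  rw [eqToHom_trans]
  exact dif_pos hV

variable {F : AbSheaf T} (φ : ∀ U : Opens T, p ∈ U → (F.obj.obj (op U) ⟶ G))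
  (hφ : ∀ (U V : Opens T) (i : op U ⟶ op V) (hU : p ∈ U) (hV : p ∈ V),
    F.obj.map i ≫ φ V hV = φ U hU)

open scoped Classical in
/-- The morphism to a skyscraper sheaf given by compatible homomorphisms from the groups of sections
over the open sets that contain the point. -/
def toSkyscraper : F ⟶ skyscraper p G :=
  ⟨{  app U :=
        if h : p ∈ U.unop then φ U.unop h ≫ eqToHom (skyscraper_obj h).symm
        else (isTerminalSkyscraperObj h).from _
      naturality U V i := by
        by_cases hV : p ∈ V.unop
        · have hU : p ∈ U.unop := leOfHom i.unop hV
          rw [dif_pos hV, dif_pos hU, ← Category.assoc, hφ U.unop V.unop i hU hV,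
            skyscraper_map i hU hV, Category.assoc, eqToHom_trans_assoc, eqToHom_refl,
            Category.id_comp]
        · exact (isTerminalSkyscraperObj hV).hom_ext _ _ }⟩

theorem toSkyscraper_app {U : Opens T} (hp : p ∈ U) :
    (toSkyscraper φ hφ).hom.app (op U) = φ U hp ≫ eqToHom (skyscraper_obj hp).symm := dif_pos hp

theorem toSkyscraper_app_eq_zero_iff {U : Opens T} {s : F.obj.obj (op U)} :
    ((toSkyscraper φ hφ).hom.app (op U)).hom s = 0 ↔ ∀ hp : p ∈ U, (φ U hp).hom s = 0 := by
  constructor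
  · intro hs hp
    have h1 : (toSkyscraper φ hφ).hom.app (op U) ≫ eqToHom (skyscraper_obj hp) = φ U hp := by
      rw [toSkyscraper_app φ hφ hp, Category.assoc, eqToHom_trans, eqToHom_refl, Category.comp_id]
    rw [← h1]
    exact (congrArg (eqToHom (skyscraper_obj hp)).hom hs).trans (map_zero _)
  · intro hs
    by_cases hp : p ∈ U
    · rw [toSkyscraper_app φ hφ hp]
      exact (congrArg (eqToHom (skyscraper_obj hp).symm).hom (hs hp)).trans (map_zero _)
    · rw [(isTerminalSkyscraperObj hp).hom_ext ((toSkyscraper φ hφ).hom.app (op U)) 0]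
      rfl

/-- A section `b` of a skyscraper sheaf is determined by an element `g` of the group, so that `b`
lifts over `V` if `g` does. -/
theorem exists_toSkyscraper_eq {U : Opens T} (b : (skyscraper p G).obj.obj (op U)) :
    ∃ g : G, ∀ (V : Opens T) (hV : V ≤ U) (s : F.obj.obj (op V)),
      (∀ hp : p ∈ V, (φ V hp).hom s = g) →
        ((toSkyscraper φ hφ).hom.app (op V)).hom s =
          ((skyscraper p G).obj.map (homOfLE hV).op).hom b := by
  have hnot : ∀ (V : Opens T) (_ : p ∉ V) (a b : (skyscraper p G).obj.obj (op V)), a = b := by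
    intro V hV a b
    have h0 : ∀ c : (skyscraper p G).obj.obj (op V), c = 0 := fun c ↦
      ConcreteCategory.congr_hom ((isTerminalSkyscraperObj hV).hom_ext (𝟙 _) 0) c
    rw [h0 a, h0 b]
  by_cases hU : p ∈ U
  · refine ⟨(eqToHom (skyscraper_obj hU)).hom b, fun V hV s hs ↦ ?_⟩
    by_cases hp : p ∈ V
    · rw [toSkyscraper_app φ hφ hp, skyscraper_map _ hU hp]
      exact congrArg (eqToHom (skyscraper_obj hp).symm).hom (hs hp)
    · exact hnot V hp _ _
  · exact ⟨0, fun V hV s _ ↦ hnot V (fun h ↦ hU (hV h)) _ _⟩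

end Skyscraper

/-! ### Ideal sheaves that differ at one point -/

noncomputable section

variable {n : ℕ} {I J m : (PSpace n).IdealSheafData} {p : PSpace n}

/-- A section of `J(d)` is a section of `I(d)` if it is so at `p`: away from `p`, where the ideal
sheaf `m` is trivial, `m * J ≤ I` says that `I` and `J` agree. -/
theorem isTwistSection_of_mem_stalkTwist (hp : IsClosed {p}) (hm : m * J ≤ I)
    (hmp : ∀ V : (PSpace n).affineOpens, p ∉ V.1 → m.ideal V = ⊤) {d : ℤ}
    {U : (PSpace n).Opens} {s : ∀ x : U, LocAt x.1} (hs : IsTwistSection J d s)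
    (h : ∀ hpU : p ∈ U, s ⟨p, hpU⟩ ∈ stalkTwist I d p) : IsTwistSection I d s := by
  rw [isTwistSection_iff] at hs ⊢
  rintro i ⟨x, hxU⟩ hx
  obtain ⟨V, hVU, hxV, f, hf, hV⟩ := hs i ⟨x, hxU⟩ hx
  by_cases hxp : x = p
  · subst hxp
    obtain ⟨W, hxW, t, ht, hst⟩ := h hxU
    rw [isTwistSection_iff] at ht
    obtain ⟨W', hWW', hxW', g, hg, hW⟩ := ht i ⟨x, hxW⟩ hx
    obtain ⟨_, h1⟩ := hV x hxV
    obtain ⟨_, h2⟩ := hW x hxW'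
    have h3 : germAt x hxV f = germAt x hxW' g :=
      (coordUnit i x hx ^ d).isUnit.mul_right_cancel (h1.symm.trans (hst.symm.trans h2))
    obtain ⟨U', hUV, hUW, hxU', e⟩ := exists_res_eq_of_germAt_eq hxV hxW' h3
    obtain ⟨V', hxV', hV'⟩ := exists_affine_le hxU'
    refine ⟨V', (hV'.trans hUV).trans hVU, hxV', _,
      I.ideal_le_comap_ideal (U := V') (V := W') (hV'.trans hUW) hg, fun y hy ↦ ?_⟩
    obtain ⟨hy', h4⟩ := hV y (hUV (hV' hy))
    refine ⟨hy', h4.trans ?_⟩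
    congr 1
    exact congrArg (germAt y (hV' hy)) e
  · obtain ⟨V', hxV', hV'⟩ := exists_affine_le (U := V.1 ⊓ ⟨{p}ᶜ, hp.isOpen_compl⟩) (x := x)
      ⟨hxV, hxp⟩
    have hpV' : p ∉ V'.1 := fun h ↦ (hV' h).2 rfl
    refine ⟨V', (hV'.trans inf_le_left).trans hVU, hxV',
      (PSpace n).presheaf.map (homOfLE (hV'.trans inf_le_left)).op f, hm V' ?_,
      fun y hy ↦ hV y (hV' hy).1⟩
    rw [Scheme.IdealSheafData.ideal_mul, Pi.mul_apply, hmp V' hpV', Ideal.top_mul]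
    exact J.ideal_le_comap_ideal (U := V') (V := V) (hV'.trans inf_le_left) hf

/-- The quotient of the stalks at `p` of `J(d)` and `I(d)`, for `I ≤ J`. It is encoded as the image
of the stalk of `J(d)` in the quotient of the localization at `p` by the stalk of `I(d)`. -/
def stalkQuotient (I J : (PSpace n).IdealSheafData) (d : ℤ) (p : PSpace n) : AddCommGrpCat.{0} :=
  AddCommGrpCat.of ((stalkTwist J d p).map (stalkTwist I d p).mkQ)

/-- A complex vector space is divisible, so it is an injective abelian group. -/
theorem injective_of_module_complex (M : Type) [AddCommGroup M] [Module ℂ M] :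
    Injective (AddCommGrpCat.of M) := by
  have : DivisibleBy M ℤ := divisibleByOfSMulRightSurj M ℤ fun {k} hk v ↦
    ⟨(k : ℂ)⁻¹ • v, by
      show k • ((k : ℂ)⁻¹ • v) = v
      rw [← Int.cast_smul_eq_zsmul ℂ, smul_inv_smul₀ (Int.cast_ne_zero.2 hk)]⟩
  exact AddCommGrpCat.injective_of_divisible M

instance (d : ℤ) : Injective (stalkQuotient I J d p) :=
  injective_of_module_complex ((stalkTwist J d p).map (stalkTwist I d p).mkQ)

/-- The inclusion of `I(d)` in `J(d)`, for `I ≤ J`. -/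
def twistIncl (hIJ : I ≤ J) (d : ℤ) : twist I d ⟶ twist J d :=
  ⟨{ app _ := AddCommGrpCat.ofHom
      { toFun s := ⟨s.1, IsTwistSection.mono hIJ s.2⟩
        map_zero' := rfl
        map_add' _ _ := rfl }
     naturality _ _ _ := rfl }⟩

/-- The class of the germ at `p` of a section of `J(d)` modulo the stalk of `I(d)`. -/
def stalkClass (I J : (PSpace n).IdealSheafData) (d : ℤ) (U : (PSpace n).Opens) (hp : p ∈ U) :
    (twist J d).obj.obj (op U) ⟶ stalkQuotient I J d p :=
  AddCommGrpCat.ofHom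
    { toFun s := ⟨(stalkTwist I d p).mkQ (s.1 ⟨p, hp⟩),
        Submodule.mem_map_of_mem (IsTwistSection.mem_stalkTwist s.2 hp)⟩
      map_zero' := Subtype.ext (map_zero (stalkTwist I d p).mkQ)
      map_add' _ _ := Subtype.ext (map_add (stalkTwist I d p).mkQ _ _) }

theorem stalkClass_eq_iff {d : ℤ} {U : (PSpace n).Opens} (hp : p ∈ U)
    (s : twistSections J d U) {v : LocAt p} (hv : v ∈ stalkTwist J d p) :
    (stalkClass I J d U hp).hom s = ⟨(stalkTwist I d p).mkQ v, Submodule.mem_map_of_mem hv⟩ ↔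
      s.1 ⟨p, hp⟩ - v ∈ stalkTwist I d p :=
  Subtype.ext_iff.trans (Submodule.Quotient.eq _)

/-- The morphism from `J(d)` to the skyscraper sheaf of the stalk at `p` of `J(d) / I(d)`. -/
def toStalkQuotient (I J : (PSpace n).IdealSheafData) (d : ℤ) (p : PSpace n) :
    twist J d ⟶ skyscraper p (stalkQuotient I J d p) :=
  toSkyscraper (F := twist J d) (fun U hp ↦ stalkClass I J d U hp) fun _ _ _ _ _ ↦ rfl

theorem toStalkQuotient_eq_zero_iff {d : ℤ} {U : (PSpace n).Opens} (s : twistSections J d U) :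
    ((toStalkQuotient I J d p).hom.app (op U)).hom s = 0 ↔
      ∀ hp : p ∈ U, s.1 ⟨p, hp⟩ ∈ stalkTwist I d p := by
  refine (toSkyscraper_app_eq_zero_iff _ _).trans (forall_congr' fun hp ↦ ?_)
  refine Subtype.ext_iff.trans ?_
  exact Submodule.Quotient.mk_eq_zero _

theorem exists_toStalkQuotient_eq {d : ℤ} {U : (PSpace n).Opens}
    (b : (skyscraper p (stalkQuotient I J d p)).obj.obj (op U)) :
    ∃ v ∈ stalkTwist J d p, ∀ (V : (PSpace n).Opens) (hV : V ≤ U) (s : twistSections J d V),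
      (∀ hp : p ∈ V, s.1 ⟨p, hp⟩ - v ∈ stalkTwist I d p) →
        ((toStalkQuotient I J d p).hom.app (op V)).hom s =
          ((skyscraper p (stalkQuotient I J d p)).obj.map (homOfLE hV).op).hom b := by
  obtain ⟨g, hg⟩ := exists_toSkyscraper_eq (F := twist J d) (fun U hp ↦ stalkClass I J d U hp)
    (fun _ _ _ _ _ ↦ rfl) b
  obtain ⟨_, v, hv, rfl⟩ := g
  exact ⟨v, hv, fun V hV s hs ↦ hg V hV s fun hp ↦ (stalkClass_eq_iff hp s hv).2 (hs hp)⟩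

/-- The sequence `0 ⟶ I(d) ⟶ J(d) ⟶ J(d) / I(d) ⟶ 0`, with the last term replaced by the skyscraper
sheaf of its stalk at `p`. -/
def twistSequence (hIJ : I ≤ J) (d : ℤ) (p : PSpace n) :
    ShortComplex (AbSheaf (PSpace n).toTopCat) where
  X₁ := twist I d
  X₂ := twist J d
  X₃ := skyscraper p (stalkQuotient I J d p)
  f := twistIncl hIJ d
  g := toStalkQuotient I J d p
  zero := by
    refine ObjectProperty.hom_ext _ ?_
    ext U s
    exact (toStalkQuotient_eq_zero_iff (J := J) (U := U.unop)
      ⟨s.1, IsTwistSection.mono hIJ s.2⟩).2 fun hp ↦ IsTwistSection.mem_stalkTwist s.2 hp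

theorem twistSequence_shortExact (hIJ : I ≤ J) (hp : IsClosed {p}) (hm : m * J ≤ I)
    (hmp : ∀ V : (PSpace n).affineOpens, p ∉ V.1 → m.ideal V = ⊤) (d : ℤ) :
    (twistSequence hIJ d p).ShortExact := by
  refine ShortComplex.ShortExact.mk' (exact_of_locally _ fun U s hs x hx ↦ ?_) ?_ ?_
  · exact ⟨U, le_rfl, hx, ⟨s.1, isTwistSection_of_mem_stalkTwist hp hm hmp s.2
      ((toStalkQuotient_eq_zero_iff (U := U) s).1 hs)⟩, rfl⟩
  · exact mono_of_injective_app _ fun V s t hst ↦ Subtype.ext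
      (congrArg (fun z : twistSections J d V ↦ z.1) hst)
  · refine epi_of_locally _ fun U b x hx ↦ ?_
    obtain ⟨v, ⟨W, hpW, s, hs, hsv⟩, hv⟩ := exists_toStalkQuotient_eq b
    by_cases hxp : x = p
    · subst hxp
      refine ⟨U ⊓ W, inf_le_left, ⟨hx, hpW⟩,
        ⟨_, mem_twistSections.2 (isTwistSection_res (V := U ⊓ W) inf_le_right hs)⟩, hv _ _ _ fun
            _ ↦ ?_⟩
      rw [← hsv, sub_self]
      exact zero_mem _
    · exact ⟨U ⊓ ⟨{p}ᶜ, hp.isOpen_compl⟩, inf_le_left, ⟨hx, hxp⟩, 0,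
        hv _ _ _ fun h ↦ (h.2 rfl).elim⟩

/-- Let `I ≤ J` be ideal sheaves such that `J / I` is annihilated by the ideal sheaf `m` of a closed
point `p`. If `J` is `r`-regular, then `I` is `(r + 1)`-regular: the skyscraper sheaf `J / I` is
acyclic, and it lifts to global sections of `J(r)`. -/
theorem IsRegular.succ_of_mul_le (hIJ : I ≤ J) (hp : IsClosed {p}) (hm : m * J ≤ I)
    (hmp : ∀ V : (PSpace n).affineOpens, p ∉ V.1 → m.ideal V = ⊤) {i : Fin (n + 1)}
    (hi : p ∈ (stdOpen n i).1) (hmax : (m.ideal (stdOpen n i)).IsMaximal) {r : ℤ}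
    (hr : IsRegular J r) : IsRegular I (r + 1) := by
  rintro (_ | _ | k) hk
  · exact absurd hk (lt_irrefl _)
  -- `H¹(I(r))`: the map `H⁰(J(r)) ⟶ H⁰(J(r) / I(r))` is surjective.
  · refine subsingleton_H_one_of_surjective (twistSequence_shortExact hIJ hp hm hmp _)
      (hr.succ 1 one_pos) fun b ↦ ?_
    obtain ⟨v, hv, hb⟩ := exists_toStalkQuotient_eq b
    have e : r + 1 - ((0 + 1 : ℕ) : ℤ) = r := by simp
    have hv' : v ∈ globalTwist J (r + 1 - ((0 + 1 : ℕ) : ℤ)) p ⊔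
        stalkTwist I (r + 1 - ((0 + 1 : ℕ) : ℤ)) p := by
      rw [e] at hv ⊢
      exact stalkTwist_le_globalTwist_sup hm hi hmax hr hv
    obtain ⟨_, ⟨s, hs, rfl⟩, w, hw, rfl⟩ := Submodule.mem_sup.1 hv'
    refine ⟨⟨s, hs⟩, (hb ⊤ le_rfl ⟨s, hs⟩ fun _ ↦ ?_).trans ?_⟩
    · rw [sub_add_cancel_left]
      exact neg_mem hw
    · exact ConcreteCategory.congr_hom ((skyscraper p (stalkQuotient I J _ p)).obj.map_id _) b
  -- `Hⁱ(I(r + 1 - i))` for `i ≥ 2`: the skyscraper sheaf has no `Hⁱ⁻¹`.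
  · have := injective_skyscraper p (stalkQuotient I J (r + 1 - ((k + 1 + 1 : ℕ) : ℤ)) p)
    have h0 : Subsingleton (Sheaf.H (skyscraper p (stalkQuotient I J
        (r + 1 - ((k + 1 + 1 : ℕ) : ℤ)) p))
      (k + 1)) := inferInstance
    exact subsingleton_ext_X₁ _ (twistSequence_shortExact hIJ hp hm hmp _) (k := k + 1)
      (hr.succ _ hk) fun y ↦ ⟨0, h0.elim _ _⟩

end

/-! ### Maximal ideal subsheaves -/

/-- A form of Nakayama's lemma: if `I ≠ J`, then `J / I` does not vanish modulo some maximal ideal.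
-/
theorem exists_isMaximal_not_le_sup_mul {A : Type*} [CommRing A] [IsNoetherianRing A]
    {I J : Ideal A} (hIJ : I ≤ J) (hne : I ≠ J) : ∃ m : Ideal A, m.IsMaximal ∧ ¬ J ≤ I ⊔ m * J := by
  obtain ⟨f, hfJ, hfI⟩ := Set.not_subset.1 fun h : (J : Set A) ⊆ I ↦ hne (le_antisymm hIJ h)
  obtain ⟨m, hm, hIm⟩ := Ideal.exists_le_maximal (Submodule.comap (LinearMap.mulRight A f) I)
    (fun h ↦ hfI (by simpa using (h ▸ trivial : (1 : A) ∈ Submodule.comap (LinearMap.mulRight A f)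
        I)))
  refine ⟨m, hm, fun h ↦ ?_⟩
  -- Some `r ≡ 1` modulo `m` satisfies `r J ≤ I`; but `r f ∈ I` implies `r ∈ m`.
  obtain ⟨r, hr, hrJ⟩ := Submodule.exists_sub_one_mem_and_smul_le_of_fg_of_le_sup
    (I := m) (N := I) (N' := J) (P := J) (IsNoetherian.noetherian J) le_rfl h
  have hrf : r * f ∈ I := hrJ (Submodule.smul_mem_pointwise_smul f r J hfJ)
  have : r ∈ m := hIm hrf
  exact hm.ne_top ((Ideal.eq_top_iff_one _).2 (by simpa using sub_mem this hr))

section Point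
variable {P : Scheme.{0}}

/-- The ideal sheaf of a closed point. -/
noncomputable def pointIdeal (p : P) (hp : IsClosed {p}) : P.IdealSheafData :=
  Scheme.IdealSheafData.vanishingIdeal ⟨{p}, hp⟩

theorem pointIdeal_of_notMem {p : P} (hp : IsClosed {p}) {V : P.affineOpens} (h : p ∉ V.1) :
    (pointIdeal p hp).ideal V = ⊤ := by
  rw [pointIdeal, Scheme.IdealSheafData.vanishingIdeal_ideal]
  have : V.2.fromSpec ⁻¹' {p} = ∅ := by
    refine Set.eq_empty_of_forall_notMem fun x hx ↦ h ?_
    rw [← V.2.opensRange_fromSpec]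
    exact ⟨x, hx⟩
  exact (congrArg PrimeSpectrum.vanishingIdeal this).trans PrimeSpectrum.vanishingIdeal_empty

theorem pointIdeal_fromSpec {V : P.affineOpens} (x : PrimeSpectrum Γ(P, V.1))
    (hp : IsClosed {V.2.fromSpec x}) :
    (pointIdeal (V.2.fromSpec x) hp).ideal V = x.asIdeal := by
  rw [pointIdeal, Scheme.IdealSheafData.vanishingIdeal_ideal]
  have : V.2.fromSpec ⁻¹' {V.2.fromSpec x} = {x} := by
    have := V.2.isOpenImmersion_fromSpec
    exact Set.ext fun y ↦ V.2.fromSpec.isOpenEmbedding.injective.eq_iff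
  exact (congrArg PrimeSpectrum.vanishingIdeal this).trans (PrimeSpectrum.vanishingIdeal_singleton
      x)

/-- Maximal ideals of the ring of an affine open set are closed points of a Jacobson scheme. -/
theorem isClosed_fromSpec [JacobsonSpace P] {V : P.affineOpens} (x : PrimeSpectrum Γ(P, V.1))
    (hx : x.asIdeal.IsMaximal) : IsClosed {V.2.fromSpec x} := by
  have := V.2.isOpenImmersion_fromSpec
  have h := V.2.fromSpec.isOpenEmbedding.preimage_closedPoints
  have hx' : x ∈ closedPoints (PrimeSpectrum Γ(P, V.1)) :=
      (PrimeSpectrum.isClosed_singleton_iff_isMaximal x).2 hx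
  have : x ∈ V.2.fromSpec ⁻¹' closedPoints P := h.symm ▸ hx'
  exact this

end Point

/-- If there is no ideal sheaf strictly between `I` and `J`, then `J / I` is annihilated by the
ideal sheaf of a closed point. -/
theorem exists_isMaximal_mul_le_of_covBy {n : ℕ} {I J : (PSpace n).IdealSheafData} (h : I ⋖ J) :
    ∃ (i : Fin (n + 1)) (p : PSpace n) (hp : IsClosed {p}), p ∈ (stdOpen n i).1 ∧
      ((pointIdeal p hp).ideal (stdOpen n i)).IsMaximal ∧ pointIdeal p hp * J ≤ I := by
  obtain ⟨i, hi⟩ : ∃ i, I.ideal (stdOpen n i) ≠ J.ideal (stdOpen n i) := by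
    by_contra! h'
    exact h.1.ne (Scheme.IdealSheafData.ext_of_iSup_eq_top _ (iSup_stdOpen n) h')
  have : IsNoetherianRing Γ(PSpace n, (stdOpen n i).1) :=
    IsLocallyNoetherian.component_noetherian (stdOpen n i)
  obtain ⟨m, hm, hJ⟩ := exists_isMaximal_not_le_sup_mul (h.1.le (stdOpen n i)) hi
  let x : PrimeSpectrum Γ(PSpace n, (stdOpen n i).1) := ⟨m, hm.isPrime⟩
  have hp := isClosed_fromSpec (P := PSpace n) (V := stdOpen n i) x hm
  have hpm := pointIdeal_fromSpec (P := PSpace n) (V := stdOpen n i) x hp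
  refine ⟨i, (stdOpen n i).2.fromSpec x, hp, ?_, by rw [hpm]; exact hm, ?_⟩
  · have : (stdOpen n i).2.fromSpec x ∈ Set.range (stdOpen n i).2.fromSpec := ⟨x, rfl⟩
    rwa [(stdOpen n i).2.range_fromSpec] at this
  · set M := pointIdeal _ hp
    have hle : I ⊔ M * J ≤ J := by
      refine sup_le h.1.le fun V ↦ ?_
      rw [Scheme.IdealSheafData.ideal_mul]
      exact Ideal.mul_le_right
    rcases h.eq_or_eq le_sup_left hle with e | e
    · exact le_sup_right.trans e.le
    · refine absurd ?_ hJ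
      have : (I ⊔ M * J).ideal (stdOpen n i) = J.ideal (stdOpen n i) := by rw [e]
      rw [Scheme.IdealSheafData.ideal_sup, Pi.sup_apply, Scheme.IdealSheafData.ideal_mul,
        Pi.mul_apply, hpm] at this
      exact this.ge

/-- Regularity goes up by at most one when one passes to a maximal ideal subsheaf. -/
theorem IsRegular.of_covBy {n : ℕ} {I J : (PSpace n).IdealSheafData} (h : I ⋖ J) {r : ℤ}
    (hr : IsRegular J r) : IsRegular I (r + 1) := by
  obtain ⟨i, p, hp, hi, hmax, hm⟩ := exists_isMaximal_mul_le_of_covBy h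
  exact hr.succ_of_mul_le h.1.le hp hm (fun V hV ↦ pointIdeal_of_notMem hp hV) hi hmax

/-! ### Finiteness of the length and induction along a chain -/

section Length

theorem le_dropPoints {A : Type*} [CommRing A] (I : Ideal A) : I ≤ dropPoints I := fun f hf ↦
  mem_dropPoints.2 fun q hq h ↦
    absurd ((Ideal.eq_top_iff_one q).2 (h 1 (by simpa using hf))) hq.ne_top

theorem le_curvePart {P : Scheme.{0}} [IsLocallyNoetherian P] [JacobsonSpace P]
    (I : P.IdealSheafData) : I ≤ curvePart I := fun U ↦ le_dropPoints (I.ideal U)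

/-- All prime ideals in the support of `dropPoints I / I` are maximal, so that this module is
Artinian. -/
theorem isArtinian_dropPoints {A : Type*} [CommRing A] [IsNoetherianRing A] (I : Ideal A) :
    IsArtinian A (Submodule.map I.mkQ (dropPoints I)) := by
  let M := Submodule.map I.mkQ (dropPoints I)
  let R := A ⧸ Module.annihilator A M
  have hR : Ring.KrullDimLE 0 R := .mk₀ fun q hq ↦ by
    have hsurj : Function.Surjective (Ideal.Quotient.mk (Module.annihilator A M)) :=
      Ideal.Quotient.mk_surjective
    let p : PrimeSpectrum A := ⟨q.comap (Ideal.Quotient.mk _), inferInstance⟩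
    have hp : p ∈ Module.support A M := by
      rw [Module.support_eq_zeroLocus]
      exact fun a ha ↦ Ideal.mem_comap.2 (by
        rw [Ideal.Quotient.eq_zero_iff_mem.2 ha]; exact zero_mem q)
    obtain ⟨⟨_, f, hf, rfl⟩, hm⟩ := Module.mem_support_iff_exists_annihilator.1 hp
    have hmax : p.asIdeal.IsMaximal := mem_dropPoints.1 hf _ p.2 fun h hh ↦ hm <| by
      rw [Submodule.mem_annihilator_span_singleton]
      refine Subtype.ext ?_
      exact (Submodule.Quotient.mk_eq_zero I).2 hh
    rw [← Ideal.map_comap_of_surjective _ hsurj q]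
    exact (Ideal.map_eq_top_or_isMaximal_of_surjective _ hsurj hmax).resolve_left fun h ↦
      hq.ne_top (by rwa [Ideal.map_comap_of_surjective _ hsurj q] at h)
  have : IsArtinianRing R := IsNoetherianRing.isArtinianRing_of_krullDimLE_zero
  let inst : Module R M := Module.quotientAnnihilator
  have : IsScalarTower A R M := Module.IsTorsionBySet.isScalarTower _
  have : Module.Finite R M := Module.Finite.of_restrictScalars_finite A R M
  exact isArtinian_of_surjective_algebraMap (R := R) Ideal.Quotient.mk_surjective

/-- Chains of ideals between `I` and `dropPoints I` have bounded length. -/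
theorem exists_strictMono_nat {A : Type*} [CommRing A] [IsNoetherianRing A] (I : Ideal A) :
    ∃ (B : ℕ) (f : Set.Icc I (dropPoints I) → ℕ), StrictMono f ∧ ∀ K, f K ≤ B := by
  have := isArtinian_dropPoints I
  let M := Submodule.map I.mkQ (dropPoints I)
  let g : Set.Icc I (dropPoints I) → Submodule A M := fun K ↦ (Submodule.map I.mkQ K.1).comap
      M.subtype
  have hmem : ∀ (K : Set.Icc I (dropPoints I)) (f : A) (hf : f ∈ dropPoints I),
      (⟨I.mkQ f, Submodule.mem_map_of_mem hf⟩ : M) ∈ g K ↔ f ∈ K.1 := by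
    intro K f hf
    refine ⟨?_, fun h ↦ Submodule.mem_map_of_mem h⟩
    rintro ⟨f', hf', e⟩
    have : f' - f ∈ K.1 := K.2.1 ((Submodule.Quotient.eq I).1 e)
    simpa using sub_mem hf' this
  have hg : StrictMono g := by
    intro K L hKL
    obtain ⟨f, hfL, hfK⟩ := SetLike.exists_of_lt (show K.1 < L.1 from hKL)
    refine lt_of_le_of_ne (Submodule.comap_mono (Submodule.map_mono hKL.le)) fun e ↦ hfK ?_
    rw [← hmem K f (L.2.2 hfL), e, hmem L f (L.2.2 hfL)]
    exact hfL
  have hfin : ∀ N : Submodule A M, Order.height N ≠ ⊤ := fun N ↦ N.height_lt_top.ne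
  refine ⟨(Order.height (⊤ : Submodule A M)).toNat, fun K ↦ (Order.height (g K)).toNat,
    fun K L hKL ↦ ?_, fun K ↦ ENat.toNat_le_toNat (Order.height_mono le_top) (hfin _)⟩
  rw [← ENat.natCast_lt_natCast, ENat.natCast_toNat (hfin _), ENat.natCast_toNat (hfin _)]
  exact Submodule.height_strictMono (hg hKL)

/-- An ideal sheaf is determined by its ideals on the finitely many `D₊(xᵢ)`, and on each of them
chains have bounded length. -/
theorem adegZero_ne_top {n : ℕ} (X : (PSpace n).IdealSheafData) : adegZero X ≠ ⊤ := by
  have : ∀ i, IsNoetherianRing Γ(PSpace n, (stdOpen n i).1) := fun i ↦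
    IsLocallyNoetherian.component_noetherian (stdOpen n i)
  choose B f hf hB using fun i ↦ exists_strictMono_nat (X.ideal (stdOpen n i))
  let r : ∀ i, Set.Icc X (curvePart X) → Set.Icc (X.ideal (stdOpen n i))
    (dropPoints (X.ideal (stdOpen n i))) := fun i K ↦
      ⟨K.1.ideal (stdOpen n i), K.2.1 _, K.2.2 _⟩
  have hr : ∀ i, Monotone (r i) := fun i K L h ↦ (show K.1 ≤ L.1 from h) (stdOpen n i)
  let F : Set.Icc X (curvePart X) → Set.Iic (∑ i, B i) := fun K ↦
    ⟨∑ i, f i (r i K), Finset.sum_le_sum fun i _ ↦ hB i _⟩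
  have hF : StrictMono F := by
    intro K L hKL
    obtain ⟨i, hi⟩ : ∃ i, K.1.ideal (stdOpen n i) ≠ L.1.ideal (stdOpen n i) := by
      by_contra! h'
      exact hKL.ne (Subtype.ext (Scheme.IdealSheafData.ext_of_iSup_eq_top _ (iSup_stdOpen n) h'))
    exact Finset.sum_lt_sum (fun j _ ↦ (hf j).monotone (hr j hKL.le)) ⟨i, Finset.mem_univ i,
      hf i (lt_of_le_of_ne (hr i hKL.le) fun h ↦ hi (congrArg Subtype.val h))⟩
  have h1 := Order.krullDim_le_of_strictMono F hF
  rw [← Order.height_eq_krullDim_Iic, Order.height_nat] at h1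
  exact (h1.trans_lt (WithBot.coe_lt_coe.2 (ENat.natCast_lt_top _))).ne

/-- An ideal sheaf `K` between `X` and its curve part is joined to the curve part by a maximal chain
of length the coheight of `K`; the regularity goes up by at most one at each step. -/
theorem isRegular_of_coheight_eq {n : ℕ} {X : (PSpace n).IdealSheafData} {r : ℤ}
    (hr : IsRegular (curvePart X) r) (l : ℕ) (K : Set.Icc X (curvePart X))
    (hK : Order.coheight K = l) : IsRegular K.1 (r + l) := by
  induction l generalizing K with
  | zero =>
    have hmax : IsMax K := Order.coheight_eq_zero.1 hK
    have h1 : K.1 = curvePart X :=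
      le_antisymm K.2.2 (hmax (b := ⟨_, le_curvePart X, le_rfl⟩) K.2.2)
    simpa [h1] using hr
  | succ l ih =>
    obtain ⟨_, ⟨L, hKL, hL⟩, hle⟩ := Order.coheight_eq_coe_add_one_iff.1 (by exact_mod_cast hK)
    have hcov : K.1 ⋖ L.1 := by
      refine ⟨hKL, fun Z hKZ hZL ↦ ?_⟩
      let Z' : Set.Icc X (curvePart X) := ⟨Z, K.2.1.trans hKZ.le, hZL.le.trans L.2.2⟩
      have h1 := hle Z' hKZ
      have h2 := Order.coheight_add_one_le (a := L) (b := Z') hZL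
      rw [hL] at h2
      have h3 := h2.trans h1
      exact absurd h3 (by exact_mod_cast Nat.not_succ_le_self l)
    have := (ih L hL).of_covBy hcov
    rwa [add_assoc] at this

end Length

end CurveReg

theorem theorem2 (n : ℕ) (X : (CurveReg.PSpace n).IdealSheafData)
    (hX : CurveReg.IsCurveWithPointComponents X) (r : ℤ)
    (hr : CurveReg.IsRegular (CurveReg.curvePart X) r) :
    ∃ l : ℕ, CurveReg.adegZero X = l ∧ CurveReg.IsRegular X (r + l) := by
  have hle := CurveReg.le_curvePart X
  have : Fact (X ≤ CurveReg.curvePart X) := ⟨hle⟩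
  have h0 : CurveReg.adegZero X =
      (Order.coheight (⟨X, le_rfl, hle⟩ : Set.Icc X (CurveReg.curvePart X)) : WithBot ℕ∞) :=
    Order.coheight_bot_eq_krullDim.symm
  have htop := CurveReg.adegZero_ne_top X
  rw [h0] at htop
  obtain ⟨l, hl⟩ := ENat.ne_top_iff_exists.1 fun h ↦ htop (congrArg _ h)
  exact ⟨l, by rw [h0, ← hl]; rfl, CurveReg.isRegular_of_coheight_eq hr l ⟨X, le_rfl, hle⟩ hl.symm⟩
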